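/- Let $q:\mathbb{R}\to\mathbb{R}$ be integrable, $q\in L^1(\mathbb{R})$, with $q\ge 0$ almost everywhere. Then the eigenvalues (counted with multiplicity) of $$-u''(x)+\left[x^2+q(x)\right]u(x)=\lambda u(x),\qquad x\in\mathbb{R},\quad u\in L^2(\mathbb{R}),$$ can be listed as a non-decreasing sequence $\lambda_0\le\lambda_1\le\lambda_2\le\cdots$, where a solution $u$ is understood to be a differentiable function whose derivative is locally absolutely continuous and which satisfies the equation almost everywhere. Let $\lambda_k^0=2k+1$ $(k=0,1,2,\dots)$ be the eigenvalues in the case $q=0$. Then, for every $n=0,1,2,\dots$, $$\sum_{k=0}^{n}\left[\lambda_k-\lambda_k^0-\frac{1}{\pi\sqrt{\lambda_k^0}}\int_{\mathbb{R}}q(x)\,dx\right]\le\frac{\chi_n}{\pi}\int_{\mathbb{R}}q(x)\,dx,$$ where $$\chi_n=\begin{cases}\displaystyle\frac{2n+3}{n+1}\,\frac{\Gamma\left(\frac n2+1\right)}{\Gamma\left(\frac{n+1}2\right)}-\sum_{k=0}^n\frac1{\sqrt{\lambda_k^0}},& n\text{ odd},\\[2ex]\displaystyle(n+1)\,\frac{\Gamma\left(\frac{n+1}2\right)}{\Gamma\left(\frac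 n2+1\right)}-\sum_{k=0}^n\frac1{\sqrt{\lambda_k^0}},& n\text{ even}.\end{cases}$$ Furthermore, $\chi_n=-Z_0(1/2)+O(1/\sqrt n)$ as $n\to\infty$, where $Z_0(s)=(1-2^{-s})\zeta(s)$ and $\zeta$ is the Riemann zeta function. -/

import Mathlib

open MeasureTheory Filter

noncomputable section

namespace PerturbedOscillator

/-- `u` is a (real) square-integrable solution of `-u'' + (x² + q) u = μ u` on the line:
`u` is differentiable, `u'` is absolutely continuous on every compact interval (so that `u''` exists
almost everywhere), the equation holds almost everywhere, and `u ∈ L²(ℝ)`. The zero function is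
included. This is the usual sense of the equation when `q` is merely locally integrable. -/
structure IsL2Solution (q : ℝ → ℝ) (μ : ℝ) (u : ℝ → ℝ) : Prop where
  differentiable : Differentiable ℝ u
  absolutelyContinuous_deriv : ∀ a b : ℝ, AbsolutelyContinuousOnInterval (deriv u) a b
  equation : ∀ᵐ x : ℝ, -deriv (deriv u) x + (x ^ 2 + q x) * u x = μ * u x
  memLp : MemLp u 2 volume

theorem ae_differentiableAt_of_ac {f : ℝ → ℝ}
    (hf : ∀ a b : ℝ, AbsolutelyContinuousOnInterval f a b) :
    ∀ᵐ x : ℝ, DifferentiableAt ℝ f x := by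
  have h : ∀ n : ℕ, ∀ᵐ x : ℝ, x ∈ Set.uIcc (-(n : ℝ)) n → DifferentiableAt ℝ f x :=
    fun n => (hf _ _).ae_differentiableAt
  filter_upwards [ae_all_iff.2 h] with x hx
  obtain ⟨n, hn⟩ := exists_nat_ge |x|
  refine hx n ?_
  rw [Set.uIcc_of_le (by linarith [abs_nonneg x])]
  exact abs_le.1 hn

/-- The eigenspace of `-d²/dx² + x² + q` on `L²(ℝ)` for `μ`. Its elements are continuous functions,
so that no two of them agree almost everywhere. -/
def eigenspace (q : ℝ → ℝ) (μ : ℝ) : Submodule ℝ (ℝ → ℝ) where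
  carrier := {u | IsL2Solution q μ u}
  zero_mem' := by
    have h0 : deriv (0 : ℝ → ℝ) = 0 := by ext x; simp
    refine ⟨differentiable_const 0, fun a b => ?_, ?_, MemLp.zero⟩
    · rw [h0]
      exact (contDiff_const (c := (0 : ℝ))).contDiffOn.absolutelyContinuousOnInterval
    · rw [h0, h0]; simp
  add_mem' := by
    intro u v hu hv
    have hd : deriv (u + v) = deriv u + deriv v := by
      ext x; exact deriv_add (hu.differentiable x) (hv.differentiable x)
    refine ⟨hu.differentiable.add hv.differentiable, fun a b => ?_, ?_, hu.memLp.add hv.memLp⟩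
    · rw [hd]
      exact (hu.absolutelyContinuous_deriv a b).add (hv.absolutelyContinuous_deriv a b)
    · filter_upwards [hu.equation, hv.equation,
        ae_differentiableAt_of_ac hu.absolutelyContinuous_deriv,
        ae_differentiableAt_of_ac hv.absolutelyContinuous_deriv] with x h1 h2 h3 h4
      rw [hd, deriv_add h3 h4]
      simp only [Pi.add_apply]
      linarith
  smul_mem' := by
    intro c u hu
    have hd : deriv (c • u) = fun x => c * deriv u x := by
      ext x; simpa using deriv_const_smul c (hu.differentiable x)
    refine ⟨hu.differentiable.const_smul c, fun a b => ?_, ?_, hu.memLp.const_smul c⟩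
    · rw [hd]
      exact (hu.absolutelyContinuous_deriv a b).const_mul c
    · filter_upwards [hu.equation,
        ae_differentiableAt_of_ac hu.absolutelyContinuous_deriv] with x h1 h3
      rw [hd, deriv_const_mul c h3]
      simp only [Pi.smul_apply, smul_eq_mul]
      linear_combination c * h1

/-- `lam 0 ≤ lam 1 ≤ ⋯` lists all eigenvalues of `-u'' + (x² + q) u = λ u`, each repeated
according to its multiplicity: every real `μ` occurs in the list exactly
`dim (eigenspace q μ)` times (in particular not at all if it is not an eigenvalue). -/
structure IsEigenvalueSequence (q : ℝ → ℝ) (lam : ℕ → ℝ) : Prop where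
  monotone : Monotone lam
  multiplicity : ∀ μ : ℝ, Module.rank ℝ (eigenspace q μ) = Cardinal.mk {k : ℕ // lam k = μ}

/-- The eigenvalues `2k + 1` of the unperturbed oscillator. -/
def harmonicEigenvalue (k : ℕ) : ℝ := 2 * k + 1

def chi (n : ℕ) : ℝ :=
  (if Odd n then
      (2 * n + 3) / (n + 1) * (Real.Gamma (n / 2 + 1) / Real.Gamma ((n + 1) / 2))
    else
      (n + 1) * (Real.Gamma ((n + 1) / 2) / Real.Gamma (n / 2 + 1)))
    - ∑ k ∈ Finset.range (n + 1), 1 / √(harmonicEigenvalue k)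

/-- The spectral zeta function `(1 - 2^(-s)) ζ(s)` of the unperturbed oscillator. -/
def spectralZeta (s : ℂ) : ℂ := (1 - 2 ^ (-s)) * riemannZeta s

end PerturbedOscillator

end

noncomputable section

namespace PerturbedOscillator

/-- The `L²`-normalized Hermite functions, defined by their three-term recurrence. -/
def hermiteFn : ℕ → ℝ → ℝ
  | 0 => fun x => √(1 / √Real.pi) * Real.exp (-x ^ 2 / 2)
  | 1 => fun x => √2 * x * (√(1 / √Real.pi) * Real.exp (-x ^ 2 / 2))
  | (n + 2) => fun x =>
      (2 * x * hermiteFn (n + 1) x - √(2 * (n + 1)) * hermiteFn n x) / √(2 * (n + 2))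

/-- The coefficient `√(2k)` of the ladder operators. -/
def ladder (k : ℕ) : ℝ := √(2 * k)

theorem ladder_sq (k : ℕ) : ladder k ^ 2 = 2 * k := Real.sq_sqrt (by positivity)

theorem ladder_zero : ladder 0 = 0 := by simp [ladder]

theorem ladder_succ_pos (k : ℕ) : 0 < ladder (k + 1) := by
  unfold ladder; positivity

theorem hermiteFn_recurrence (k : ℕ) (x : ℝ) :
    2 * x * hermiteFn k x = ladder (k + 1) * hermiteFn (k + 1) x
      + ladder k * hermiteFn (k - 1) x := by
  cases k with
  | zero =>
    have h : √(2 : ℝ) * √2 = 2 := Real.mul_self_sqrt (by norm_num)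
    simp only [ladder, hermiteFn]
    norm_num
    linear_combination (-x * ((√√Real.pi)⁻¹ * Real.exp (-x ^ 2 / 2))) * h
  | succ n =>
    have h : ladder (n + 1 + 1) ≠ 0 := (ladder_succ_pos _).ne'
    have e : ladder (n + 1 + 1) = √(2 * ((n : ℝ) + 2)) := by
      unfold ladder; push_cast; ring_nf
    have e' : ladder (n + 1) = √(2 * ((n : ℝ) + 1)) := by
      unfold ladder; push_cast; ring_nf
    rw [show hermiteFn (n + 1 + 1) x = (2 * x * hermiteFn (n + 1) x
      - √(2 * (n + 1)) * hermiteFn n x) / √(2 * (n + 2)) from rfl, ← e, ← e']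
    field_simp
    simp

theorem hasDerivAt_hermiteFn (k : ℕ) (x : ℝ) :
    HasDerivAt (hermiteFn k) (ladder k * hermiteFn (k - 1) x - x * hermiteFn k x) x := by
  have h0 : ∀ x, HasDerivAt (hermiteFn 0) (-(x * hermiteFn 0 x)) x := by
    intro x
    have h : HasDerivAt (fun x : ℝ => -x ^ 2 / 2) (-x) x := by
      refine ((hasDerivAt_pow 2 x).fun_neg.div_const 2).congr_deriv ?_
      push_cast; ring
    refine (h.exp.const_mul √(1 / √Real.pi)).congr_deriv ?_
    rw [hermiteFn]; ring
  induction k using Nat.strong_induction_on generalizing x with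
  | _ k ih =>
    cases k with
    | zero => simpa [ladder_zero] using h0 x
    | succ n =>
      have hpos := (ladder_succ_pos n).ne'
      have e : hermiteFn (n + 1) = fun x =>
          (2 * x * hermiteFn n x - ladder n * hermiteFn (n - 1) x) / ladder (n + 1) := by
        ext y
        rw [hermiteFn_recurrence]; field_simp; ring
      have h1 := ih n (by omega) x
      have h2 : HasDerivAt (fun x => ladder n * hermiteFn (n - 1) x)
          (ladder n * (x * hermiteFn (n - 1) x - ladder n * hermiteFn n x)) x := by
        cases n with
        | zero => simpa [ladder_zero] using hasDerivAt_const x (0 : ℝ)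
        | succ m =>
          refine ((ih m (by omega) x).congr_deriv ?_).const_mul _
          simp only [Nat.add_sub_cancel]
          linear_combination -(hermiteFn_recurrence m x)
      have h3 := ((((hasDerivAt_id x).const_mul 2).mul h1).sub h2).div_const (ladder (n + 1))
      rw [e]
      refine h3.congr_deriv ?_
      have hr := hermiteFn_recurrence n x
      have hs := ladder_sq n
      have hs' := ladder_sq (n + 1)
      push_cast at hs'
      field_simp
      simp only [id, Nat.add_sub_cancel]
      linear_combination (-hermiteFn n x) * hs' + hermiteFn n x * hs

theorem hasDerivAt_hermiteFn' (k : ℕ) (x : ℝ) :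
    HasDerivAt (hermiteFn k) (x * hermiteFn k x - ladder (k + 1) * hermiteFn (k + 1) x) x := by
  refine (hasDerivAt_hermiteFn k x).congr_deriv ?_
  linear_combination -(hermiteFn_recurrence k x)

theorem deriv_hermiteFn (k : ℕ) :
    deriv (hermiteFn k) = fun x => x * hermiteFn k x - ladder (k + 1) * hermiteFn (k + 1) x :=
  funext fun x => (hasDerivAt_hermiteFn' k x).deriv

theorem hasDerivAt_deriv_hermiteFn (k : ℕ) (x : ℝ) :
    HasDerivAt (deriv (hermiteFn k)) ((x ^ 2 - (2 * k + 1)) * hermiteFn k x) x := by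
  rw [deriv_hermiteFn]
  refine (((hasDerivAt_id x).mul (hasDerivAt_hermiteFn' k x)).sub
    ((hasDerivAt_hermiteFn (k + 1) x).const_mul (ladder (k + 1)))).congr_deriv ?_
  have hs' := ladder_sq (k + 1)
  push_cast at hs'
  simp only [id, Nat.add_sub_cancel]
  linear_combination (-hermiteFn k x) * hs'

theorem differentiable_hermiteFn (k : ℕ) : Differentiable ℝ (hermiteFn k) :=
  fun x => (hasDerivAt_hermiteFn k x).differentiableAt

theorem continuous_hermiteFn (k : ℕ) : Continuous (hermiteFn k) :=
  (differentiable_hermiteFn k).continuous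

theorem contDiff_hermiteFn (k : ℕ) : ContDiff ℝ 2 (hermiteFn k) := by
  rw [show (2 : WithTop ℕ∞) = 1 + 1 from rfl, contDiff_succ_iff_deriv]
  refine ⟨differentiable_hermiteFn k, by simp, ?_⟩
  rw [contDiff_one_iff_deriv]
  refine ⟨fun x => (hasDerivAt_deriv_hermiteFn k x).differentiableAt, ?_⟩
  have : deriv (deriv (hermiteFn k)) = fun x => (x ^ 2 - (2 * k + 1)) * hermiteFn k x :=
    funext fun x => (hasDerivAt_deriv_hermiteFn k x).deriv
  rw [this]
  have := continuous_hermiteFn k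
  fun_prop

/-- The diagonal `∑_{k ≤ n} h_k(x)²` of the Christoffel–Darboux kernel. -/
def christoffel (n : ℕ) (x : ℝ) : ℝ := ∑ k ∈ Finset.range (n + 1), hermiteFn k x ^ 2

theorem christoffel_succ (n : ℕ) (x : ℝ) :
    christoffel (n + 1) x = christoffel n x + hermiteFn (n + 1) x ^ 2 :=
  Finset.sum_range_succ _ _

theorem hasDerivAt_christoffel (n : ℕ) (x : ℝ) :
    HasDerivAt (christoffel n) (-(ladder (n + 1) * hermiteFn n x * hermiteFn (n + 1) x)) x := by
  induction n with
  | zero =>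
    have : christoffel 0 = fun x => hermiteFn 0 x ^ 2 := by ext; simp [christoffel]
    rw [this]
    refine ((hasDerivAt_hermiteFn 0 x).pow 2).congr_deriv ?_
    have := hermiteFn_recurrence 0 x
    simp only [ladder_zero] at this ⊢
    linear_combination (-hermiteFn 0 x) * this
  | succ n ih =>
    have : christoffel (n + 1) = fun x => christoffel n x + hermiteFn (n + 1) x ^ 2 :=
      funext (christoffel_succ n)
    rw [this]
    refine (ih.add ((hasDerivAt_hermiteFn (n + 1) x).pow 2)).congr_deriv ?_
    have := hermiteFn_recurrence (n + 1) x
    simp only [Nat.add_sub_cancel] at this ⊢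
    push_cast
    linear_combination (-hermiteFn (n + 1) x) * this

theorem hasDerivAt_christoffel_add (n : ℕ) (x : ℝ) :
    HasDerivAt (fun x => christoffel n x + christoffel (n + 1) x)
      (-(2 * x * hermiteFn (n + 1) x ^ 2)) x := by
  refine ((hasDerivAt_christoffel n x).add (hasDerivAt_christoffel (n + 1) x)).congr_deriv ?_
  have := hermiteFn_recurrence (n + 1) x
  simp only [Nat.add_sub_cancel] at this ⊢
  linear_combination hermiteFn (n + 1) x * this

theorem two_mul_christoffel_le (n : ℕ) (x : ℝ) :
    2 * christoffel n x ≤ christoffel n 0 + christoffel (n + 1) 0 := by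
  have h1 : 2 * christoffel n x ≤ christoffel n x + christoffel (n + 1) x := by
    rw [christoffel_succ]; nlinarith [sq_nonneg (hermiteFn (n + 1) x)]
  refine h1.trans ?_
  have hd := hasDerivAt_christoffel_add n
  have hc : Continuous (fun x => christoffel n x + christoffel (n + 1) x) :=
    continuous_iff_continuousAt.2 fun x => (hd x).continuousAt
  rcases le_total 0 x with hx | hx
  · refine antitoneOn_of_deriv_nonpos (convex_Ici (0 : ℝ)) hc.continuousOn
      (fun y _ => (hd y).differentiableAt.differentiableWithinAt) (fun y hy => ?_)
      Set.self_mem_Ici hx hx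
    rw [interior_Ici] at hy
    rw [(hd y).deriv]
    have : 0 ≤ 2 * y * hermiteFn (n + 1) y ^ 2 := by
      have : 0 < y := hy
      positivity
    linarith
  · refine monotoneOn_of_deriv_nonneg (convex_Iic (0 : ℝ)) hc.continuousOn
      (fun y _ => (hd y).differentiableAt.differentiableWithinAt) (fun y hy => ?_)
      hx Set.self_mem_Iic hx
    rw [interior_Iic] at hy
    rw [(hd y).deriv]
    have : 0 ≤ 2 * (-y) * hermiteFn (n + 1) y ^ 2 := by
      have : 0 < -y := by simpa using hy
      positivity
    linarith

theorem hermiteFn_add_two_zero_sq (n : ℕ) :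
    (n + 2) * hermiteFn (n + 2) 0 ^ 2 = (n + 1) * hermiteFn n 0 ^ 2 := by
  have h := hermiteFn_recurrence (n + 1) 0
  have h1 := ladder_sq (n + 1)
  have h2 := ladder_sq (n + 2)
  push_cast at h1 h2
  simp only [Nat.add_sub_cancel] at h
  have h3 : ladder (n + 2) * hermiteFn (n + 2) 0 = -(ladder (n + 1) * hermiteFn n 0) := by
    linear_combination -h
  have h4 : ladder (n + 2) ^ 2 * hermiteFn (n + 2) 0 ^ 2
      = ladder (n + 1) ^ 2 * hermiteFn n 0 ^ 2 := by
    rw [← mul_pow, ← mul_pow, h3, neg_sq]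
  rw [h1, h2] at h4
  linarith

theorem christoffel_add_zero (n : ℕ) :
    christoffel n 0 + christoffel (n + 1) 0
      = 2 * (n + 1) * hermiteFn n 0 ^ 2 + (2 * n + 3) * hermiteFn (n + 1) 0 ^ 2 := by
  induction n with
  | zero =>
    simp [christoffel, hermiteFn, Finset.sum_range_succ]
    ring
  | succ n ih =>
    rw [christoffel_succ n, christoffel_succ (n + 1)]
    have := hermiteFn_add_two_zero_sq n
    rw [christoffel_succ n] at ih ⊢
    push_cast
    linear_combination ih - 2 * this

theorem hermiteFn_zero_odd (m : ℕ) : hermiteFn (2 * m + 1) 0 = 0 := by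
  induction m with
  | zero => simp [hermiteFn]
  | succ m ih =>
    have h := hermiteFn_add_two_zero_sq (2 * m + 1)
    rw [ih] at h
    have h2 : hermiteFn (2 * m + 1 + 2) 0 ^ 2 = 0 := by
      rcases mul_eq_zero.1 (h.trans (by ring)) with h | h
      · exfalso; push_cast at h; linarith [(Nat.cast_nonneg m : (0 : ℝ) ≤ m)]
      · exact h
    exact pow_eq_zero_iff (two_ne_zero) |>.1 h2

theorem hermiteFn_zero_even (m : ℕ) :
    hermiteFn (2 * m) 0 ^ 2 = Real.Gamma (m + 1 / 2) / (Real.pi * Real.Gamma (m + 1)) := by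
  induction m with
  | zero =>
    have h : (√Real.pi) ^ 2 = Real.pi := Real.sq_sqrt Real.pi_pos.le
    have h' : √Real.pi ≠ 0 := by positivity
    simp only [hermiteFn]
    rw [mul_pow, Real.sq_sqrt (by positivity)]
    norm_num
    rw [show (1 / 2 : ℝ) = 1 / 2 from rfl, Real.Gamma_one_half_eq]
    field_simp
    linarith
  | succ m ih =>
    have h := hermiteFn_add_two_zero_sq (2 * m)
    rw [show 2 * (m + 1) = 2 * m + 2 by ring]
    rw [ih] at h
    have e1 : Real.Gamma ((m + 1 : ℕ) + 1 / 2) = (m + 1 / 2) * Real.Gamma (m + 1 / 2) := by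
      rw [← Real.Gamma_add_one (by positivity)]; push_cast; ring_nf
    have e2 : Real.Gamma ((m + 1 : ℕ) + 1) = (m + 1) * Real.Gamma (m + 1) := by
      rw [← Real.Gamma_add_one (by positivity)]; push_cast; ring_nf
    rw [e1, e2]
    have h3 := Real.Gamma_pos_of_pos (show (0 : ℝ) < m + 1 by positivity)
    have h4 := Real.pi_pos
    push_cast at h
    have h5 : hermiteFn (2 * m + 2) 0 ^ 2 = (2 * m + 1) * (Real.Gamma (m + 1 / 2) /
        (Real.pi * Real.Gamma (m + 1))) / (2 * m + 2) := by
      rw [← h]; field_simp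
    rw [h5]
    field_simp

/-- The Gamma-function expression in `chi`. -/
def gammaTerm (n : ℕ) : ℝ :=
  if Odd n then
    (2 * n + 3) / (n + 1) * (Real.Gamma (n / 2 + 1) / Real.Gamma ((n + 1) / 2))
  else
    (n + 1) * (Real.Gamma ((n + 1) / 2) / Real.Gamma (n / 2 + 1))

theorem chi_eq (n : ℕ) :
    chi n = gammaTerm n - ∑ k ∈ Finset.range (n + 1), 1 / √(harmonicEigenvalue k) := rfl

theorem christoffel_add_zero_eq_gammaTerm (n : ℕ) :
    christoffel n 0 + christoffel (n + 1) 0 = 2 * (gammaTerm n / Real.pi) := by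
  have hpi := Real.pi_pos
  rw [christoffel_add_zero]
  rcases Nat.even_or_odd' n with ⟨m, rfl | rfl⟩
  · rw [gammaTerm, if_neg (by simp), hermiteFn_zero_odd, hermiteFn_zero_even]
    have h := Real.Gamma_pos_of_pos (show (0 : ℝ) < m + 1 by positivity)
    push_cast
    rw [show ((2 * m + 1) / 2 : ℝ) = m + 1 / 2 by ring, show (2 * m / 2 + 1 : ℝ) = m + 1 by ring]
    field_simp
    ring
  · rw [gammaTerm, if_pos (by simp), hermiteFn_zero_odd,
      show 2 * m + 1 + 1 = 2 * (m + 1) by ring, hermiteFn_zero_even]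
    have h := Real.Gamma_pos_of_pos (show (0 : ℝ) < m + 1 by positivity)
    have e2 : Real.Gamma ((m + 1 : ℕ) + 1) = (m + 1) * Real.Gamma (m + 1) := by
      rw [← Real.Gamma_add_one (by positivity)]; push_cast; ring_nf
    rw [e2]
    push_cast
    rw [show ((2 * m + 1) / 2 + 1 : ℝ) = m + 1 + 1 / 2 by ring,
      show ((2 * m + 1 + 1) / 2 : ℝ) = m + 1 by ring]
    field_simp
    ring

/-- The sharp pointwise bound on the sum of the squares of the first Hermite functions. -/
theorem christoffel_le (n : ℕ) (x : ℝ) : christoffel n x ≤ gammaTerm n / Real.pi := by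
  have := two_mul_christoffel_le n x
  rw [christoffel_add_zero_eq_gammaTerm] at this
  linarith

theorem gamma_add_half_sq_le {x : ℝ} (hx : 0 < x) :
    Real.Gamma (x + 1 / 2) ^ 2 ≤ x * Real.Gamma x ^ 2 := by
  have h := Real.Gamma_mul_add_mul_le_rpow_Gamma_mul_rpow_Gamma hx
    (show 0 < x + 1 by linarith) (show (0 : ℝ) < 1 / 2 by norm_num)
    (show (0 : ℝ) < 1 / 2 by norm_num) (by norm_num)
  rw [show 1 / 2 * x + 1 / 2 * (x + 1) = x + 1 / 2 by ring] at h
  have h1 := Real.Gamma_pos_of_pos hx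
  have h2 := Real.Gamma_pos_of_pos (show 0 < x + 1 by linarith)
  have h3 := Real.Gamma_pos_of_pos (show 0 < x + 1 / 2 by linarith)
  rw [← Real.sqrt_eq_rpow, ← Real.sqrt_eq_rpow, ← Real.sqrt_mul h1.le, Real.le_sqrt' h3] at h
  rw [Real.Gamma_add_one hx.ne'] at h
  linarith

theorem gammaTerm_pos (n : ℕ) : 0 < gammaTerm n := by
  have h1 := Real.Gamma_pos_of_pos (show 0 < ((n : ℝ) + 1) / 2 by positivity)
  have h2 := Real.Gamma_pos_of_pos (show 0 < (n : ℝ) / 2 + 1 by positivity)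
  unfold gammaTerm
  split_ifs <;> positivity

theorem gammaTerm_sq_mem (n : ℕ) :
    2 * (n : ℝ) + 2 ≤ gammaTerm n ^ 2 ∧ gammaTerm n ^ 2 ≤ 2 * n + 5 := by
  set x : ℝ := ((n : ℝ) + 1) / 2 with hx
  have hn : (n : ℝ) = 2 * x - 1 := by rw [hx]; ring
  have hn0 : (0 : ℝ) ≤ n := Nat.cast_nonneg n
  have hx2 : 1 / 2 ≤ x := by rw [hx]; linarith
  have hx0 : 0 < x := by linarith
  have g1 := Real.Gamma_pos_of_pos hx0
  have g2 := Real.Gamma_pos_of_pos (show 0 < x + 1 / 2 by linarith)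
  have u := gamma_add_half_sq_le hx0
  have l := gamma_add_half_sq_le (show 0 < x + 1 / 2 by linarith)
  rw [show x + 1 / 2 + 1 / 2 = x + 1 by ring, Real.Gamma_add_one hx0.ne'] at l
  have e : (n : ℝ) / 2 + 1 = x + 1 / 2 := by rw [hx]; ring
  set a := Real.Gamma x
  set b := Real.Gamma (x + 1 / 2)
  have hpos := gammaTerm_pos n
  unfold gammaTerm
  rw [← hx, e, hn]
  split_ifs with hodd
  · have e2 : (2 * (2 * x - 1) + 3) / (2 * x - 1 + 1) * (b / a) = (4 * x + 1) * b / (2 * x * a) := by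
      rw [show 2 * (2 * x - 1) + 3 = 4 * x + 1 by ring, show 2 * x - 1 + 1 = 2 * x by ring]
      field_simp
    rw [e2, div_pow, le_div_iff₀ (by positivity), div_le_iff₀ (by positivity)]
    constructor
    · have h1 : (x * a) ^ 2 * ((4 * x + 1) ^ 2 * 2) ≤ (x + 1 / 2) * b ^ 2 * ((4 * x + 1) ^ 2 * 2) :=
        mul_le_mul_of_nonneg_right l (by positivity)
      have h2 : 16 * x * (x + 1 / 2) * (x * a) ^ 2 ≤ (4 * x + 1) ^ 2 * (x * a) ^ 2 :=
        mul_le_mul_of_nonneg_right (by nlinarith) (by positivity)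
      have h3 : 0 < x + 1 / 2 := by linarith
      refine le_of_mul_le_mul_right ?_ h3
      nlinarith
    · have h1 : b ^ 2 * (4 * x + 1) ^ 2 ≤ x * a ^ 2 * (4 * x + 1) ^ 2 :=
        mul_le_mul_of_nonneg_right u (by positivity)
      have h2 : x * a ^ 2 * (4 * x + 1) ^ 2 ≤ (2 * (2 * x - 1) + 5) * (2 * x * a) ^ 2 := by
        have : 0 ≤ x * a ^ 2 * ((2 * (2 * x - 1) + 5) * 4 * x - (4 * x + 1) ^ 2) := by
          refine mul_nonneg (by positivity) ?_
          nlinarith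
        nlinarith
      nlinarith
  · rw [show 2 * x - 1 + 1 = 2 * x by ring, show 2 * x * (a / b) = 2 * x * a / b by ring, div_pow,
      le_div_iff₀ (by positivity), div_le_iff₀ (by positivity)]
    constructor
    · nlinarith
    · nlinarith [sq_nonneg b]

theorem gammaTerm_le (n : ℕ) : gammaTerm n ≤ 3 * √(n + 1) := by
  have h := (gammaTerm_sq_mem n).2
  have hn0 : (0 : ℝ) ≤ n := Nat.cast_nonneg n
  refine le_of_sq_le_sq ?_ (by positivity)
  rw [mul_pow, Real.sq_sqrt (by positivity)]
  linarith

theorem abs_gammaTerm_sub_le {n : ℕ} (hn : 0 < n) :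
    |gammaTerm n - √(2 * n)| ≤ 5 / √n := by
  obtain ⟨h1, h2⟩ := gammaTerm_sq_mem n
  have hn0 : (0 : ℝ) < n := Nat.cast_pos.2 hn
  have hs : √(2 * (n : ℝ)) ^ 2 = 2 * n := Real.sq_sqrt (by positivity)
  have hs' : √(n : ℝ) ^ 2 = n := Real.sq_sqrt (by positivity)
  have h4 : 0 < √(n : ℝ) := by positivity
  have h5 : √(n : ℝ) ≤ √(2 * (n : ℝ)) := Real.sqrt_le_sqrt (by linarith)
  have h6 := gammaTerm_pos n
  have h7 : √(2 * (n : ℝ)) ≤ gammaTerm n := le_of_sq_le_sq (by linarith) h6.le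
  rw [abs_of_nonneg (by linarith), le_div_iff₀ h4]
  have h8 : (gammaTerm n - √(2 * n)) * (gammaTerm n + √(2 * n)) ≤ 5 := by nlinarith
  refine le_trans ?_ h8
  exact mul_le_mul_of_nonneg_left (by linarith) (by linarith)

/-- `(1 - s)` times the error of the `n`-th step in comparing `∑ k⁻ˢ` with `∫ t⁻ˢ`. -/
def zetaStep (n : ℕ) (s : ℂ) : ℂ :=
  (1 - s) * ((n : ℂ) + 2) ^ (-s) - (((n : ℂ) + 2) ^ (1 - s) - ((n : ℂ) + 1) ^ (1 - s))

theorem norm_zetaStep_le (n : ℕ) {s : ℂ} (hs : 0 < s.re) :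
    ‖zetaStep n s‖ ≤ ‖1 - s‖ * ‖s‖ * ((n : ℝ) + 1) ^ (-s.re - 1) := by
  have hn0 : (0 : ℝ) ≤ n := Nat.cast_nonneg n
  set I := Set.Icc ((n : ℝ) + 1) (n + 2) with hI
  have hpos : ∀ t ∈ I, 0 < t := fun t ht => by have := ht.1; linarith
  have hpow : ∀ r : ℂ, ∀ t ∈ I, HasDerivAt (fun y : ℝ => (y : ℂ) ^ r) (r * (t : ℂ) ^ (r - 1)) t := by
    intro r t ht
    have := (((hasDerivAt_id (t : ℂ)).cpow_const (c := r)
      (Or.inl (by simpa using hpos t ht)))).comp_ofReal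
    simpa using this
  have hend : ((n : ℝ) + 2) ∈ I := ⟨by linarith, le_refl _⟩
  have hend' : ((n : ℝ) + 1) ∈ I := ⟨le_refl _, by linarith⟩
  have h1 : ∀ t ∈ I, ‖(((n : ℝ) + 2 : ℝ) : ℂ) ^ (-s) - (t : ℂ) ^ (-s)‖
      ≤ ‖s‖ * ((n : ℝ) + 1) ^ (-s.re - 1) := by
    intro t ht
    refine (Convex.norm_image_sub_le_of_norm_hasDerivWithin_le (C := ‖s‖ * ((n : ℝ) + 1) ^ (-s.re - 1))
      (fun x hx => (hpow (-s) x hx).hasDerivWithinAt) (fun x hx => ?_) (convex_Icc _ _) ht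
      hend).trans ?_
    · rw [norm_mul, norm_neg, Complex.norm_cpow_eq_rpow_re_of_pos (hpos x hx)]
      refine mul_le_mul_of_nonneg_left ?_ (norm_nonneg _)
      simp only [Complex.sub_re, Complex.neg_re, Complex.one_re]
      exact Real.rpow_le_rpow_of_nonpos (by positivity) hx.1 (by linarith)
    · refine mul_le_of_le_one_right (by positivity) ?_
      rw [Real.norm_eq_abs, abs_of_nonneg (by linarith [ht.2])]
      linarith [ht.1]
  have h2 := Convex.norm_image_sub_le_of_norm_hasDerivWithin_le
    (f := fun t : ℝ => (1 - s) * (((n : ℝ) + 2 : ℝ) : ℂ) ^ (-s) * t - (t : ℂ) ^ (1 - s))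
    (f' := fun t : ℝ => (1 - s) * ((((n : ℝ) + 2 : ℝ) : ℂ) ^ (-s) - (t : ℂ) ^ (-s)))
    (s := I) (C := ‖1 - s‖ * (‖s‖ * ((n : ℝ) + 1) ^ (-s.re - 1))) (fun t ht => ?_) (fun t ht => ?_)
    (convex_Icc _ _) hend' hend
  · refine le_trans (le_of_eq ?_) (h2.trans (le_of_eq ?_))
    · congr 1
      unfold zetaStep
      push_cast
      ring
    · simp; ring
  · have h3 := (((hasDerivAt_id (t : ℂ)).const_mul
      ((1 - s) * (((n : ℝ) + 2 : ℝ) : ℂ) ^ (-s))).comp_ofReal.sub (hpow (1 - s) t ht))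
    refine (h3.congr_deriv ?_).hasDerivWithinAt
    rw [show 1 - s - 1 = -s by ring]; ring
  · rw [norm_mul]
    exact mul_le_mul_of_nonneg_left (h1 t ht) (norm_nonneg _)

theorem sum_zetaStep (s : ℂ) (N : ℕ) :
    ∑ n ∈ Finset.range N, zetaStep n s
      = (1 - s) * (∑ k ∈ Finset.range (N + 1), 1 / ((k : ℂ) + 1) ^ s - 1)
        - ((N : ℂ) + 1) ^ (1 - s) + 1 := by
  induction N with
  | zero => simp
  | succ N ih =>
    rw [Finset.sum_range_succ, ih, Finset.sum_range_succ _ (N + 1), zetaStep, Complex.cpow_neg]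
    push_cast
    rw [show (N : ℂ) + 1 + 1 = N + 2 by ring]
    ring

def zetaRegion : Set ℂ := {s | 1 / 4 < s.re} ∩ Metric.ball 0 5

theorem norm_zetaStep_le_of_mem (n : ℕ) {s : ℂ} (hs : s ∈ zetaRegion) :
    ‖zetaStep n s‖ ≤ 30 * ((n : ℝ) + 1) ^ (-(5 / 4) : ℝ) := by
  obtain ⟨h1, h2⟩ := hs
  have h1 : 1 / 4 < s.re := h1
  rw [mem_ball_zero_iff] at h2
  refine (norm_zetaStep_le n (by linarith)).trans ?_
  have h3 : ‖1 - s‖ ≤ 6 := (norm_sub_le _ _).trans (by simp; linarith)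
  have h4 : ‖1 - s‖ * ‖s‖ ≤ 6 * 5 := by gcongr
  refine mul_le_mul (by linarith) ?_ (by positivity) (by norm_num)
  exact Real.rpow_le_rpow_of_exponent_le (by linarith [(Nat.cast_nonneg n : (0 : ℝ) ≤ n)])
    (by linarith)

theorem summable_zetaStep_bound :
    Summable (fun n : ℕ => 30 * ((n : ℝ) + 1) ^ (-(5 / 4) : ℝ)) := by
  have := (summable_nat_add_iff 1).2 (Real.summable_nat_rpow.2 (show (-(5 / 4) : ℝ) < -1 by norm_num))
  refine (this.mul_left 30).congr fun n => ?_
  push_cast; rfl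

theorem tsum_zetaStep_of_one_lt_re {s : ℂ} (hs : 1 < s.re) (hs' : s ∈ zetaRegion) :
    ∑' n, zetaStep n s = (1 - s) * (riemannZeta s - 1) + 1 := by
  have hsum : Summable (fun n => zetaStep n s) :=
    Summable.of_norm_bounded summable_zetaStep_bound fun n => norm_zetaStep_le_of_mem n hs'
  refine tendsto_nhds_unique hsum.hasSum.tendsto_sum_nat ?_
  simp_rw [sum_zetaStep]
  have h1 : Summable (fun k : ℕ => 1 / ((k : ℂ) + 1) ^ s) := by
    have := (summable_nat_add_iff 1).2 (Complex.summable_one_div_nat_cpow.2 hs)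
    refine this.congr fun n => ?_
    push_cast; rfl
  have h2 := h1.hasSum.tendsto_sum_nat.comp (tendsto_add_atTop_nat 1)
  rw [← zeta_eq_tsum_one_div_nat_add_one_cpow hs] at h2
  have h3 : Tendsto (fun N : ℕ => ((N : ℂ) + 1) ^ (1 - s)) atTop (nhds 0) := by
    rw [tendsto_zero_iff_norm_tendsto_zero]
    have h4 : ∀ N : ℕ, ‖((N : ℂ) + 1) ^ (1 - s)‖ = ((N : ℝ) + 1) ^ (-(s.re - 1)) := by
      intro N
      have := Complex.norm_cpow_eq_rpow_re_of_pos (x := (N : ℝ) + 1) (by positivity) (1 - s)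
      push_cast at this
      rw [this]; simp
    simp_rw [h4]
    have := (tendsto_rpow_neg_atTop (show 0 < s.re - 1 by linarith)).comp
      ((tendsto_natCast_atTop_atTop (R := ℝ)).atTop_add (tendsto_const_nhds (x := (1 : ℝ))))
    exact this
  simpa using (((h2.sub_const 1).const_mul (1 - s)).sub h3).add_const 1

theorem tsum_zetaStep_eq {s : ℂ} (hs : s ∈ zetaRegion) :
    ∑' n, zetaStep n s = s - riemannZeta₁ s := by
  have hopen : IsOpen zetaRegion :=
    (isOpen_lt continuous_const Complex.continuous_re).inter Metric.isOpen_ball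
  have hconv : Convex ℝ zetaRegion :=
    (convex_halfSpace_re_gt _).inter (convex_ball _ _)
  have hdiff : DifferentiableOn ℂ (fun w => ∑' n, zetaStep n w) zetaRegion := by
    refine Complex.differentiableOn_tsum_of_summable_norm summable_zetaStep_bound (fun n => ?_) hopen
      fun n w hw => norm_zetaStep_le_of_mem n hw
    have h1 : (n : ℂ) + 1 ≠ 0 := by exact_mod_cast n.succ_ne_zero
    have h2 : (n : ℂ) + 2 ≠ 0 := by exact_mod_cast (n + 1).succ_ne_zero
    intro w _
    unfold zetaStep
    refine DifferentiableAt.differentiableWithinAt ?_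
    have e1 : DifferentiableAt ℂ (fun s : ℂ => ((n : ℂ) + 2) ^ (-s)) w :=
      DifferentiableAt.const_cpow (by fun_prop) (Or.inl h2)
    have e2 : DifferentiableAt ℂ (fun s : ℂ => ((n : ℂ) + 2) ^ (1 - s)) w :=
      DifferentiableAt.const_cpow (by fun_prop) (Or.inl h2)
    have e3 : DifferentiableAt ℂ (fun s : ℂ => ((n : ℂ) + 1) ^ (1 - s)) w :=
      DifferentiableAt.const_cpow (by fun_prop) (Or.inl h1)
    fun_prop
  have h2mem : (2 : ℂ) ∈ zetaRegion := ⟨by simp; norm_num, by simp; norm_num⟩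
  refine AnalyticOnNhd.eqOn_of_preconnected_of_eventuallyEq (hdiff.analyticOnNhd hopen)
    (g := fun s => s - riemannZeta₁ s)
    ((by fun_prop : Differentiable ℂ fun s => s - riemannZeta₁ s).differentiableOn.analyticOnNhd
      hopen) hconv.isPreconnected h2mem ?_ hs
  have : ∀ᶠ s : ℂ in nhds 2, 1 < s.re :=
    (isOpen_lt continuous_const Complex.continuous_re).mem_nhds (by simp)
  filter_upwards [this, hopen.mem_nhds h2mem] with s h1 h2
  rw [tsum_zetaStep_of_one_lt_re h1 h2]
  have hne : s ≠ 1 := by rintro rfl; simp at h1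
  have : s - 1 ≠ 0 := sub_ne_zero.2 hne
  rw [riemannZeta_eq_inv_sub_mul hne]
  field_simp
  ring

/-- The regularized partial sums `∑_{k ≤ N} k^{-1/2} - 2√N`. -/
def halfSum (N : ℕ) : ℝ := ∑ k ∈ Finset.range N, 1 / √((k : ℝ) + 1) - 2 * √(N : ℝ)

theorem tendsto_halfSum :
    Tendsto (fun N => (halfSum (N + 1) : ℂ)) atTop (nhds (riemannZeta (1 / 2))) := by
  have hmem : (1 / 2 : ℂ) ∈ zetaRegion := ⟨by simp; norm_num, by simp; norm_num⟩
  have hsum : Summable (fun n => zetaStep n (1 / 2)) :=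
    Summable.of_norm_bounded summable_zetaStep_bound fun n => norm_zetaStep_le_of_mem n hmem
  have h := hsum.hasSum.tendsto_sum_nat
  rw [tsum_zetaStep_eq hmem] at h
  have hp : ∀ x : ℝ, 0 ≤ x → (x : ℂ) ^ (1 / 2 : ℂ) = (√x : ℝ) := by
    intro x hx
    rw [Real.sqrt_eq_rpow, Complex.ofReal_cpow hx]; norm_num
  have e : ∀ N : ℕ, (halfSum (N + 1) : ℂ)
      = 2 * ∑ n ∈ Finset.range N, zetaStep n (1 / 2) - 1 := by
    intro N
    rw [sum_zetaStep]
    have h1 : ∀ k : ℕ, ((k : ℂ) + 1) ^ (1 / 2 : ℂ) = (√((k : ℝ) + 1) : ℝ) := by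
      intro k
      rw [← hp _ (by positivity)]; push_cast; rfl
    rw [show (1 - 1 / 2 : ℂ) = 1 / 2 by norm_num]
    simp_rw [h1]
    unfold halfSum
    push_cast
    ring
  simp_rw [e]
  have hne : (1 / 2 : ℂ) ≠ 1 := by norm_num
  convert (h.const_mul 2).sub_const 1 using 2
  rw [riemannZeta_eq_inv_sub_mul hne]
  norm_num
  ring

theorem halfSum_step {N : ℕ} (hN : 0 < N) :
    halfSum (N + 1) ≤ halfSum N ∧
      halfSum N - 1 / √(N : ℝ) ≤ halfSum (N + 1) - 1 / √((N + 1 : ℕ) : ℝ) := by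
  have hN0 : (0 : ℝ) < N := Nat.cast_pos.2 hN
  have h1 : 0 < √(N : ℝ) := by positivity
  have h2 : 0 < √((N : ℝ) + 1) := by positivity
  have h3 : √(N : ℝ) ^ 2 = N := Real.sq_sqrt hN0.le
  have h4 : √((N : ℝ) + 1) ^ 2 = N + 1 := Real.sq_sqrt (by positivity)
  have h5 : √(N : ℝ) ≤ √((N : ℝ) + 1) := Real.sqrt_le_sqrt (by linarith)
  have h6 : (√((N : ℝ) + 1) - √(N : ℝ)) * (√((N : ℝ) + 1) + √(N : ℝ)) = 1 := by nlinarith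
  have h7 : √((N : ℝ) + 1) - √(N : ℝ) = 1 / (√((N : ℝ) + 1) + √(N : ℝ)) := by
    rw [eq_div_iff (by positivity), h6]
  have h8 : 1 / √((N : ℝ) + 1) ≤ 2 * (√((N : ℝ) + 1) - √(N : ℝ)) := by
    rw [h7, mul_one_div, div_le_div_iff₀ h2 (by positivity)]
    linarith
  have h9 : 2 * (√((N : ℝ) + 1) - √(N : ℝ)) ≤ 1 / √(N : ℝ) := by
    rw [h7, mul_one_div, div_le_div_iff₀ (by positivity) h1]
    linarith
  unfold halfSum
  rw [Finset.sum_range_succ]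
  push_cast
  constructor <;> linarith

theorem abs_halfSum_sub_le {N M : ℕ} (hN : 0 < N) (hM : N ≤ M) :
    |halfSum M - halfSum N| ≤ 1 / √(N : ℝ) := by
  have h : halfSum M ≤ halfSum N ∧ halfSum N - 1 / √(N : ℝ) ≤ halfSum M - 1 / √(M : ℝ) := by
    induction M, hM using Nat.le_induction with
    | base => simp
    | succ M hM ih =>
      have := halfSum_step (hN.trans_le hM)
      exact ⟨this.1.trans ih.1, ih.2.trans this.2⟩
  have h1 : 0 ≤ 1 / √(M : ℝ) := by positivity
  rw [abs_le]
  constructor <;> linarith [h.1, h.2]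

theorem norm_halfSum_sub_riemannZeta_le {N : ℕ} (hN : 0 < N) :
    ‖(halfSum N : ℂ) - riemannZeta (1 / 2)‖ ≤ 1 / √(N : ℝ) := by
  have h := (tendsto_const_nhds (x := (halfSum N : ℂ))).sub tendsto_halfSum
  refine le_of_tendsto h.norm ?_
  filter_upwards [eventually_ge_atTop N] with M hM
  rw [norm_sub_rev, ← Complex.ofReal_sub, Complex.norm_real]
  exact abs_halfSum_sub_le hN (by omega)

theorem sum_inv_sqrt_harmonicEigenvalue (n : ℕ) :
    ∑ k ∈ Finset.range (n + 1), 1 / √(harmonicEigenvalue k)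
      = halfSum (2 * n + 1) + 2 * √(2 * n + 1) - 1 / √2 * halfSum n - √(2 * n) := by
  have key : ∑ k ∈ Finset.range (n + 1), 1 / √(harmonicEigenvalue k)
      = ∑ j ∈ Finset.range (2 * n + 1), 1 / √((j : ℝ) + 1)
        - 1 / √2 * ∑ j ∈ Finset.range n, 1 / √((j : ℝ) + 1) := by
    induction n with
    | zero => simp [harmonicEigenvalue]
    | succ n ih =>
      rw [Finset.sum_range_succ, ih, show 2 * (n + 1) + 1 = 2 * n + 1 + 1 + 1 by ring,
        Finset.sum_range_succ _ (2 * n + 1 + 1), Finset.sum_range_succ _ (2 * n + 1),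
        Finset.sum_range_succ _ n]
      have : √(((2 * n + 1 : ℕ) : ℝ) + 1) = √2 * √((n : ℝ) + 1) := by
        rw [← Real.sqrt_mul (by norm_num)]; push_cast; ring_nf
      rw [this]
      unfold harmonicEigenvalue
      push_cast
      field_simp
      ring_nf
  rw [key]
  unfold halfSum
  have h2 : √(2 : ℝ) ^ 2 = 2 := Real.sq_sqrt (by norm_num)
  have h3 : √(2 * (n : ℝ)) = √2 * √(n : ℝ) := Real.sqrt_mul (by norm_num) _
  rw [h3]
  push_cast
  field_simp
  linear_combination √(n : ℝ) * h2

theorem norm_chi_add_spectralZeta_le {n : ℕ} (hn : 0 < n) :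
    ‖(chi n : ℂ) - -spectralZeta (1 / 2)‖ ≤ 9 * (1 / √(n : ℝ)) := by
  have hn0 : (0 : ℝ) < n := Nat.cast_pos.2 hn
  have h1 := abs_gammaTerm_sub_le hn
  have h2 := norm_halfSum_sub_riemannZeta_le hn
  have h3 := norm_halfSum_sub_riemannZeta_le (show 0 < 2 * n + 1 by omega)
  have hsn : 0 < √(n : ℝ) := by positivity
  have h4 : 1 / √((2 * n + 1 : ℕ) : ℝ) ≤ 1 / √(n : ℝ) := by
    refine one_div_le_one_div_of_le hsn (Real.sqrt_le_sqrt ?_)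
    push_cast; linarith
  have h5 : |√(2 * (n : ℝ) + 1) - √(2 * n)| ≤ 1 / √(n : ℝ) := by
    have a1 : √(2 * (n : ℝ) + 1) ^ 2 = 2 * n + 1 := Real.sq_sqrt (by positivity)
    have a2 : √(2 * (n : ℝ)) ^ 2 = 2 * n := Real.sq_sqrt (by positivity)
    have a3 : √(2 * (n : ℝ)) ≤ √(2 * n + 1) := Real.sqrt_le_sqrt (by linarith)
    have a4 : √(n : ℝ) ≤ √(2 * n) := Real.sqrt_le_sqrt (by linarith)
    rw [abs_of_nonneg (by linarith), le_div_iff₀ hsn]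
    nlinarith [Real.sqrt_nonneg (2 * (n : ℝ) + 1)]
  have hc : (2 : ℂ) ^ (-(1 / 2) : ℂ) = ((1 / √2 : ℝ) : ℂ) := by
    rw [Complex.cpow_neg, Real.sqrt_eq_rpow]
    push_cast
    rw [Complex.ofReal_cpow (by norm_num)]
    norm_num
  have hc1 : ‖((1 / √2 : ℝ) : ℂ)‖ ≤ 1 := by
    rw [Complex.norm_real, Real.norm_eq_abs, abs_of_nonneg (by positivity)]
    rw [div_le_one (by positivity)]
    exact Real.one_le_sqrt.2 (by norm_num)
  have e : (chi n : ℂ) - -spectralZeta (1 / 2)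
      = ((gammaTerm n - √(2 * n) : ℝ) : ℂ) - 2 * ((√(2 * (n : ℝ) + 1) - √(2 * n) : ℝ) : ℂ)
        - ((halfSum (2 * n + 1) : ℂ) - riemannZeta (1 / 2))
        + ((1 / √2 : ℝ) : ℂ) * ((halfSum n : ℂ) - riemannZeta (1 / 2)) := by
    rw [chi_eq, sum_inv_sqrt_harmonicEigenvalue, spectralZeta, hc]
    push_cast
    ring
  rw [e]
  have n1 : ‖((gammaTerm n - √(2 * n) : ℝ) : ℂ)‖ ≤ 5 * (1 / √(n : ℝ)) := by
    rw [Complex.norm_real, Real.norm_eq_abs]; linarith [mul_one_div 5 √(n : ℝ)]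
  have n2 : ‖2 * ((√(2 * (n : ℝ) + 1) - √(2 * n) : ℝ) : ℂ)‖ ≤ 2 * (1 / √(n : ℝ)) := by
    rw [norm_mul, Complex.norm_real, Real.norm_eq_abs]
    simpa using h5
  have n3 : ‖((1 / √2 : ℝ) : ℂ) * ((halfSum n : ℂ) - riemannZeta (1 / 2))‖ ≤ 1 / √(n : ℝ) := by
    rw [norm_mul]
    exact (mul_le_of_le_one_left (norm_nonneg _) hc1).trans h2
  refine (norm_add_le _ _).trans ?_
  refine (add_le_add ((norm_sub_le _ _).trans (add_le_add (norm_sub_le _ _) le_rfl)) le_rfl).trans ?_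
  linarith

theorem chi_asymptotics :
    (fun n : ℕ => (chi n : ℂ) - -spectralZeta (1 / 2)) =O[atTop] (fun n : ℕ => 1 / √(n : ℝ)) := by
  refine Asymptotics.IsBigO.of_bound 9 ?_
  filter_upwards [eventually_gt_atTop 0] with n hn
  refine (norm_chi_add_spectralZeta_le hn).trans_eq ?_
  rw [Real.norm_eq_abs, abs_of_nonneg (by positivity)]

/-- Continuous functions decaying, together with all their products with polynomials, at least
like `exp (-x²/4)`. -/
def IsRapid (f : ℝ → ℝ) : Prop :=
  Continuous f ∧ ∀ n : ℕ, ∃ C, ∀ x, |x ^ n * f x| ≤ C * Real.exp (-x ^ 2 / 4)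

theorem IsRapid.const_mul {f : ℝ → ℝ} (hf : IsRapid f) (c : ℝ) : IsRapid (fun x => c * f x) := by
  refine ⟨hf.1.const_mul c, fun n => ?_⟩
  obtain ⟨C, hC⟩ := hf.2 n
  refine ⟨|c| * C, fun x => ?_⟩
  rw [show x ^ n * (c * f x) = c * (x ^ n * f x) by ring, abs_mul, mul_assoc]
  exact mul_le_mul_of_nonneg_left (hC x) (abs_nonneg c)

theorem IsRapid.sub {f g : ℝ → ℝ} (hf : IsRapid f) (hg : IsRapid g) :
    IsRapid (fun x => f x - g x) := by
  refine ⟨hf.1.sub hg.1, fun n => ?_⟩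
  obtain ⟨C, hC⟩ := hf.2 n
  obtain ⟨D, hD⟩ := hg.2 n
  refine ⟨C + D, fun x => ?_⟩
  rw [mul_sub, add_mul]
  exact (abs_sub _ _).trans (add_le_add (hC x) (hD x))

theorem IsRapid.id_mul {f : ℝ → ℝ} (hf : IsRapid f) : IsRapid (fun x => x * f x) := by
  refine ⟨continuous_id.mul hf.1, fun n => ?_⟩
  obtain ⟨C, hC⟩ := hf.2 (n + 1)
  refine ⟨C, fun x => ?_⟩
  rw [show x ^ n * (x * f x) = x ^ (n + 1) * f x by ring]
  exact hC x

theorem IsRapid.pow_mul {f : ℝ → ℝ} (hf : IsRapid f) (n : ℕ) : IsRapid (fun x => x ^ n * f x) := by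
  refine ⟨(continuous_pow n).mul hf.1, fun m => ?_⟩
  obtain ⟨C, hC⟩ := hf.2 (m + n)
  refine ⟨C, fun x => ?_⟩
  rw [show x ^ m * (x ^ n * f x) = x ^ (m + n) * f x by ring]
  exact hC x

theorem IsRapid.exists_bound {f : ℝ → ℝ} (hf : IsRapid f) :
    ∃ C, 0 ≤ C ∧ ∀ x, |f x| ≤ C * Real.exp (-x ^ 2 / 4) := by
  obtain ⟨C, hC⟩ := hf.2 0
  refine ⟨C, ?_, fun x => by simpa using hC x⟩
  have := (abs_nonneg _).trans (hC 0)
  simpa using this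

theorem isRapid_hermiteFn (k : ℕ) : IsRapid (hermiteFn k) := by
  induction k using Nat.strong_induction_on with
  | _ k ih =>
    match k, ih with
    | 0, _ =>
      have : IsRapid (fun x => Real.exp (-x ^ 2 / 2)) := by
        refine ⟨by fun_prop, fun n => ⟨n.factorial * Real.exp 1, fun x => ?_⟩⟩
        rw [abs_mul, abs_of_pos (Real.exp_pos _), abs_pow]
        have h1 : |x| ^ n ≤ n.factorial * Real.exp |x| := by
          have := Real.pow_div_factorial_le_exp |x| (abs_nonneg x) n
          rwa [div_le_iff₀ (by positivity), mul_comm] at this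
        calc |x| ^ n * Real.exp (-x ^ 2 / 2)
            ≤ n.factorial * Real.exp |x| * Real.exp (-x ^ 2 / 2) :=
              mul_le_mul_of_nonneg_right h1 (Real.exp_pos _).le
          _ = n.factorial * Real.exp (|x| + -x ^ 2 / 2) := by rw [Real.exp_add]; ring
          _ ≤ n.factorial * Real.exp (1 + -x ^ 2 / 4) := by
              gcongr n.factorial * Real.exp ?_
              nlinarith [sq_nonneg (|x| / 2 - 1), sq_abs x]
          _ = n.factorial * Real.exp 1 * Real.exp (-x ^ 2 / 4) := by rw [Real.exp_add]; ring
      exact this.const_mul _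
    | 1, ih => 
      convert (ih 0 (by omega)).id_mul.const_mul (√2) using 2 with x
      simp only [hermiteFn]; ring
    | n + 2, ih =>
      convert ((((ih (n + 1) (by omega)).id_mul.const_mul 2).sub
        ((ih n (by omega)).const_mul √(2 * ((n : ℝ) + 1)))).const_mul (√(2 * ((n : ℝ) + 2)))⁻¹)
        using 2 with x
      rw [hermiteFn]; ring

theorem isRapid_deriv_hermiteFn (k : ℕ) : IsRapid (deriv (hermiteFn k)) := by
  rw [deriv_hermiteFn]
  exact (isRapid_hermiteFn k).id_mul.sub ((isRapid_hermiteFn (k + 1)).const_mul _)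

/-- Functions growing at most like `exp |x|`. -/
def ExpBounded (m : ℝ → ℝ) : Prop := ∃ A, ∀ x, |m x| ≤ A * Real.exp |x|

theorem ExpBounded.exists_nonneg {m : ℝ → ℝ} (hm : ExpBounded m) :
    ∃ A, 0 ≤ A ∧ ∀ x, |m x| ≤ A * Real.exp |x| := by
  obtain ⟨A, hA⟩ := hm
  refine ⟨A, ?_, hA⟩
  simpa using (abs_nonneg _).trans (hA 0)

theorem ExpBounded.of_abs_le {m : ℝ → ℝ} {M : ℝ} (h : ∀ x, |m x| ≤ M) : ExpBounded m := by
  refine ⟨M, fun x => (h x).trans ?_⟩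
  exact le_mul_of_one_le_right ((abs_nonneg _).trans (h 0)) (Real.one_le_exp (abs_nonneg x))

theorem ExpBounded.add {m₁ m₂ : ℝ → ℝ} (h₁ : ExpBounded m₁) (h₂ : ExpBounded m₂) :
    ExpBounded (fun x => m₁ x + m₂ x) := by
  obtain ⟨A, hA⟩ := h₁
  obtain ⟨B, hB⟩ := h₂
  refine ⟨A + B, fun x => (abs_add_le _ _).trans ?_⟩
  rw [add_mul]
  exact add_le_add (hA x) (hB x)

theorem ExpBounded.const_mul {m : ℝ → ℝ} (h : ExpBounded m) (c : ℝ) :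
    ExpBounded (fun x => c * m x) := by
  obtain ⟨A, hA⟩ := h
  refine ⟨|c| * A, fun x => ?_⟩
  rw [abs_mul, mul_assoc]
  exact mul_le_mul_of_nonneg_left (hA x) (abs_nonneg c)

theorem expBounded_id : ExpBounded (fun x => x) :=
  ⟨1, fun x => by linarith [Real.add_one_le_exp |x|]⟩

theorem integrable_exp_mul_abs_mul_gaussian (t : ℝ) :
    Integrable (fun x : ℝ => Real.exp (t * |x|) * Real.exp (-x ^ 2 / 4)) := by
  have h := (integrable_exp_neg_mul_sq (show (0 : ℝ) < 1 / 8 by norm_num)).const_mul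
    (Real.exp (2 * t ^ 2))
  refine h.mono' (by fun_prop) (Eventually.of_forall fun x => ?_)
  rw [Real.norm_eq_abs, abs_of_pos (by positivity), ← Real.exp_add, ← Real.exp_add]
  apply Real.exp_le_exp.2
  nlinarith [sq_nonneg (|x| - 4 * t), sq_abs x]

theorem integrable_mul_of_rapid {m f : ℝ → ℝ} (hm : AEStronglyMeasurable m)
    (hm' : ExpBounded m) (hf : IsRapid f) : Integrable (fun x => m x * f x) := by
  obtain ⟨A, hA0, hA⟩ := hm'.exists_nonneg
  obtain ⟨C, hC0, hC⟩ := hf.exists_bound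
  refine ((integrable_exp_mul_abs_mul_gaussian 1).const_mul (A * C)).mono'
    (hm.mul hf.1.aestronglyMeasurable) (Eventually.of_forall fun x => ?_)
  rw [Real.norm_eq_abs, abs_mul]
  calc |m x| * |f x| ≤ (A * Real.exp |x|) * (C * Real.exp (-x ^ 2 / 4)) :=
        mul_le_mul (hA x) (hC x) (abs_nonneg _) (by positivity)
    _ = A * C * (Real.exp (1 * |x|) * Real.exp (-x ^ 2 / 4)) := by rw [one_mul]; ring

theorem IsRapid.integrable {f : ℝ → ℝ} (hf : IsRapid f) : Integrable f := by
  simpa using integrable_mul_of_rapid (m := fun _ => 1) (by fun_prop)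
    (ExpBounded.of_abs_le (M := 1) (by simp)) hf

theorem IsRapid.expBounded {f : ℝ → ℝ} (hf : IsRapid f) : ExpBounded f := by
  obtain ⟨C, hC0, hC⟩ := hf.exists_bound
  refine ExpBounded.of_abs_le (M := C) fun x => (hC x).trans ?_
  exact mul_le_of_le_one_right hC0 (Real.exp_le_one_iff.2 (by nlinarith [sq_nonneg x]))

theorem integrable_mul_of_rapid' {r f : ℝ → ℝ} (hr : Integrable r) (hf : IsRapid f) :
    Integrable (fun x => r x * f x) := by
  obtain ⟨C, hC0, hC⟩ := hf.exists_bound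
  refine hr.mul_bdd (c := C) hf.1.aestronglyMeasurable (Eventually.of_forall fun x => ?_)
  exact (hC x).trans (mul_le_of_le_one_right hC0 (Real.exp_le_one_iff.2 (by nlinarith [sq_nonneg x])))

theorem abs_mul_le_of_rapid {m f : ℝ → ℝ} (hm : ExpBounded m) (hf : IsRapid f) :
    ∃ K, ∀ x, |m x * f x| ≤ K * Real.exp (-|x|) := by
  obtain ⟨A, hA0, hA⟩ := hm.exists_nonneg
  obtain ⟨C, hC0, hC⟩ := hf.exists_bound
  refine ⟨A * C * Real.exp 4, fun x => ?_⟩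
  rw [abs_mul]
  calc |m x| * |f x| ≤ (A * Real.exp |x|) * (C * Real.exp (-x ^ 2 / 4)) :=
        mul_le_mul (hA x) (hC x) (abs_nonneg _) (by positivity)
    _ = A * C * (Real.exp (|x| + -x ^ 2 / 4)) := by rw [Real.exp_add]; ring
    _ ≤ A * C * Real.exp (4 + -|x|) := by
        gcongr A * C * Real.exp ?_
        nlinarith [sq_nonneg (|x| / 2 - 2), sq_abs x]
    _ = A * C * Real.exp 4 * Real.exp (-|x|) := by rw [Real.exp_add]; ring

theorem tendsto_mul_of_rapid_atTop {m f : ℝ → ℝ} (hm : ExpBounded m) (hf : IsRapid f) :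
    Tendsto (fun x => m x * f x) atTop (nhds 0) := by
  obtain ⟨K, hK⟩ := abs_mul_le_of_rapid hm hf
  have h : Tendsto (fun x : ℝ => K * Real.exp (-|x|)) atTop (nhds (K * 0)) :=
    (Real.tendsto_exp_neg_atTop_nhds_zero.comp tendsto_abs_atTop_atTop).const_mul K
  rw [mul_zero] at h
  exact squeeze_zero_norm hK h

theorem tendsto_mul_of_rapid_atBot {m f : ℝ → ℝ} (hm : ExpBounded m) (hf : IsRapid f) :
    Tendsto (fun x => m x * f x) atBot (nhds 0) := by
  obtain ⟨K, hK⟩ := abs_mul_le_of_rapid hm hf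
  have h : Tendsto (fun x : ℝ => K * Real.exp (-|x|)) atBot (nhds (K * 0)) :=
    (Real.tendsto_exp_neg_atTop_nhds_zero.comp tendsto_abs_atBot_atTop).const_mul K
  rw [mul_zero] at h
  exact squeeze_zero_norm hK h

theorem integrable_hermiteFn_mul (j k : ℕ) :
    Integrable (fun x => hermiteFn j x * hermiteFn k x) :=
  integrable_mul_of_rapid (continuous_hermiteFn j).aestronglyMeasurable
    (isRapid_hermiteFn j).expBounded (isRapid_hermiteFn k)

theorem integral_hermiteFn_mul_of_ne {j k : ℕ} (hjk : j ≠ k) :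
    ∫ x, hermiteFn j x * hermiteFn k x = 0 := by
  have hd : ∀ x, HasDerivAt
      (fun x => hermiteFn j x * deriv (hermiteFn k) x - hermiteFn k x * deriv (hermiteFn j) x)
      ((2 * j - 2 * k) * (hermiteFn j x * hermiteFn k x)) x := by
    intro x
    have h1 := (differentiable_hermiteFn j x).hasDerivAt
    have h2 := (differentiable_hermiteFn k x).hasDerivAt
    refine ((h1.mul (hasDerivAt_deriv_hermiteFn k x)).sub
      (h2.mul (hasDerivAt_deriv_hermiteFn j x))).congr_deriv ?_
    ring
  have h := integral_of_hasDerivAt_of_tendsto hd ((integrable_hermiteFn_mul j k).const_mul _)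
    ((tendsto_mul_of_rapid_atBot (isRapid_hermiteFn j).expBounded (isRapid_deriv_hermiteFn k)).sub
      (tendsto_mul_of_rapid_atBot (isRapid_hermiteFn k).expBounded (isRapid_deriv_hermiteFn j)))
    ((tendsto_mul_of_rapid_atTop (isRapid_hermiteFn j).expBounded (isRapid_deriv_hermiteFn k)).sub
      (tendsto_mul_of_rapid_atTop (isRapid_hermiteFn k).expBounded (isRapid_deriv_hermiteFn j)))
  rw [integral_const_mul] at h
  have hne : (2 * j - 2 * k : ℝ) ≠ 0 := by
    intro h
    exact hjk (by exact_mod_cast (by linarith : (j : ℝ) = k))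
  simpa [hne] using h

theorem integral_hermiteFn_sq (k : ℕ) : ∫ x, hermiteFn k x * hermiteFn k x = 1 := by
  induction k with
  | zero =>
    have h : ∀ x, hermiteFn 0 x * hermiteFn 0 x = 1 / √Real.pi * Real.exp (-1 * x ^ 2) := by
      intro x
      have e : (√(1 / √Real.pi)) ^ 2 = 1 / √Real.pi := Real.sq_sqrt (by positivity)
      have e2 : Real.exp (-x ^ 2 / 2) * Real.exp (-x ^ 2 / 2) = Real.exp (-1 * x ^ 2) := by
        rw [← Real.exp_add]; ring_nf
      rw [hermiteFn, ← e2]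
      linear_combination (Real.exp (-x ^ 2 / 2) * Real.exp (-x ^ 2 / 2)) * e
    simp_rw [h]
    rw [integral_const_mul, integral_gaussian, div_one]
    have : √Real.pi ≠ 0 := by positivity
    field_simp
  | succ k ih =>
    have e : ∀ x, ladder (k + 1) * (hermiteFn (k + 1) x * hermiteFn (k + 1) x)
        + ladder k * (hermiteFn (k - 1) x * hermiteFn (k + 1) x)
        = ladder (k + 2) * (hermiteFn k x * hermiteFn (k + 2) x)
        + ladder (k + 1) * (hermiteFn k x * hermiteFn k x) := by
      intro x
      have h1 := hermiteFn_recurrence k x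
      have h2 := hermiteFn_recurrence (k + 1) x
      simp only [Nat.add_sub_cancel] at h2
      linear_combination (-hermiteFn (k + 1) x) * h1 + hermiteFn k x * h2
    have h := integral_congr_ae (μ := volume) (Eventually.of_forall e)
    have I := fun (a : ℝ) j k => (integrable_hermiteFn_mul j k).const_mul a
    rw [integral_add (I _ _ _) (I _ _ _), integral_add (I _ _ _) (I _ _ _)] at h
    simp only [integral_const_mul] at h
    rw [integral_hermiteFn_mul_of_ne (show k - 1 ≠ k + 1 by omega),
      integral_hermiteFn_mul_of_ne (show k ≠ k + 2 by omega), ih] at h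
    have := (ladder_succ_pos k).ne'
    simpa [this] using h

theorem integral_hermiteFn_mul (j k : ℕ) :
    ∫ x, hermiteFn j x * hermiteFn k x = if j = k then 1 else 0 := by
  split_ifs with h
  · rw [h, integral_hermiteFn_sq]
  · exact integral_hermiteFn_mul_of_ne h

theorem pow_mul_gaussian_mem_span (n : ℕ) :
    (fun x : ℝ => x ^ n * hermiteFn 0 x) ∈ Submodule.span ℝ (Set.range hermiteFn) := by
  have key : ∀ f ∈ Submodule.span ℝ (Set.range hermiteFn),
      (fun x : ℝ => x * f x) ∈ Submodule.span ℝ (Set.range hermiteFn) := by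
    intro f hf
    induction hf using Submodule.span_induction with
    | mem f hf =>
      obtain ⟨k, rfl⟩ := hf
      have : (fun x => x * hermiteFn k x) = (ladder (k + 1) / 2) • hermiteFn (k + 1)
          + (ladder k / 2) • hermiteFn (k - 1) := by
        ext x
        have := hermiteFn_recurrence k x
        simp only [Pi.add_apply, Pi.smul_apply, smul_eq_mul]
        linarith
      rw [this]
      exact add_mem (Submodule.smul_mem _ _ (Submodule.subset_span ⟨_, rfl⟩))
        (Submodule.smul_mem _ _ (Submodule.subset_span ⟨_, rfl⟩))
    | zero => simp only [Pi.zero_apply, mul_zero]; exact zero_mem _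
    | add f g _ _ hf hg =>
      have : (fun x => x * (f + g) x) = (fun x => x * f x) + fun x => x * g x := by
        ext x; simp [mul_add]
      rw [this]; exact add_mem hf hg
    | smul c f _ hf =>
      have : (fun x => x * (c • f) x) = c • fun x => x * f x := by
        ext x; simp; ring
      rw [this]; exact Submodule.smul_mem _ _ hf
  induction n with
  | zero =>
    simp only [pow_zero, one_mul]
    exact Submodule.subset_span (Set.mem_range_self 0)
  | succ n ih =>
    convert key _ ih using 2 with x
    ring

theorem integral_mul_pow_gaussian_eq_zero {f : ℝ → ℝ} (hf : Continuous f) (hb : ExpBounded f)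
    (h0 : ∀ k, ∫ x, f x * hermiteFn k x = 0) (n : ℕ) :
    ∫ x, f x * (x ^ n * hermiteFn 0 x) = 0 := by
  have key : ∀ g ∈ Submodule.span ℝ (Set.range hermiteFn),
      Integrable (fun x => f x * g x) ∧ ∫ x, f x * g x = 0 := by
    intro g hg
    induction hg using Submodule.span_induction with
    | mem g hg =>
      obtain ⟨k, rfl⟩ := hg
      exact ⟨integrable_mul_of_rapid hf.aestronglyMeasurable hb (isRapid_hermiteFn k), h0 k⟩
    | zero => simp
    | add g₁ g₂ _ _ h₁ h₂ =>
      simp only [Pi.add_apply, mul_add]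
      exact ⟨h₁.1.add h₂.1, by rw [integral_add h₁.1 h₂.1, h₁.2, h₂.2, add_zero]⟩
    | smul c g _ h =>
      simp only [Pi.smul_apply, smul_eq_mul, mul_left_comm _ c]
      exact ⟨h.1.const_mul c, by rw [integral_const_mul, h.2, mul_zero]⟩
  exact (key _ (pow_mul_gaussian_mem_span n)).2

open FourierTransform in
/-- Completeness of the Hermite functions in the class of continuous functions of at most
exponential growth. -/
theorem eq_zero_of_integral_mul_hermiteFn {f : ℝ → ℝ} (hf : Continuous f) (hb : ExpBounded f)
    (h0 : ∀ k, ∫ x, f x * hermiteFn k x = 0) (x : ℝ) : f x = 0 := by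
  set F : ℝ → ℂ := fun x => ((f x * hermiteFn 0 x : ℝ) : ℂ) with hF
  have hFc : Continuous F := Complex.continuous_ofReal.comp (hf.mul (continuous_hermiteFn 0))
  have hFi : Integrable F :=
    (integrable_mul_of_rapid hf.aestronglyMeasurable hb (isRapid_hermiteFn 0)).ofReal
  obtain ⟨A, hA0, hA⟩ := hb.exists_nonneg
  obtain ⟨C, hC0, hC⟩ := (isRapid_hermiteFn 0).exists_bound
  have hFb : ∀ x, ‖F x‖ ≤ A * C * (Real.exp |x| * Real.exp (-x ^ 2 / 4)) := by
    intro x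
    rw [hF, Complex.norm_real, Real.norm_eq_abs, abs_mul]
    calc |f x| * |hermiteFn 0 x| ≤ (A * Real.exp |x|) * (C * Real.exp (-x ^ 2 / 4)) :=
          mul_le_mul (hA x) (hC x) (abs_nonneg _) (by positivity)
      _ = _ := by ring
  have hzero : 𝓕 F = 0 := by
    ext ξ
    rw [Real.fourier_eq']
    set c : ℂ := -2 * Real.pi * Complex.I * ξ with hc
    have hs := hasSum_integral_of_dominated_convergence (μ := volume)
      (F := fun (n : ℕ) (v : ℝ) => (c * v) ^ n / (n.factorial : ℂ) * F v)
      (f := fun v => Complex.exp (c * v) * F v)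
      (fun n v => (‖c‖ * |v|) ^ n / n.factorial * (A * C * (Real.exp |v| * Real.exp (-v ^ 2 / 4))))
      (fun n => by fun_prop) (fun n => Eventually.of_forall fun v => ?_)
      (Eventually.of_forall fun v => ?_) ?_ (Eventually.of_forall fun v => ?_)
    · have h1 : ∀ n : ℕ, ∫ v : ℝ, (c * v) ^ n / (n.factorial : ℂ) * F v = 0 := by
        intro n
        have h2 : ∀ v : ℝ, (c * v) ^ n / (n.factorial : ℂ) * F v
            = c ^ n / n.factorial * ((f v * (v ^ n * hermiteFn 0 v) : ℝ) : ℂ) := by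
          intro v; rw [hF]; push_cast; ring
        simp_rw [h2]
        rw [integral_const_mul, integral_complex_ofReal,
          integral_mul_pow_gaussian_eq_zero hf hb h0]
        simp
      simp_rw [h1] at hs
      have h3 := hs.unique hasSum_zero
      rw [Pi.zero_apply, ← h3]
      congr 1
      ext v
      rw [smul_eq_mul, hc]
      congr 2
      simp
      ring
    · rw [norm_mul, norm_div, norm_pow, norm_mul, Complex.norm_real, Real.norm_eq_abs,
        Complex.norm_natCast]
      exact mul_le_mul_of_nonneg_left (hFb v) (by positivity)
    · exact (Real.summable_pow_div_factorial _).mul_right _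
    · have h1 : ∀ v : ℝ, ∑' n : ℕ, (‖c‖ * |v|) ^ n / (n.factorial : ℝ)
          * (A * C * (Real.exp |v| * Real.exp (-v ^ 2 / 4)))
          = A * C * (Real.exp ((‖c‖ + 1) * |v|) * Real.exp (-v ^ 2 / 4)) := by
        intro v
        have := (NormedSpace.expSeries_div_hasSum_exp (𝔸 := ℝ) (‖c‖ * |v|)).mul_right
          (A * C * (Real.exp |v| * Real.exp (-v ^ 2 / 4)))
        rw [this.tsum_eq, ← Real.exp_eq_exp_ℝ, add_mul, one_mul, Real.exp_add]
        ring
      simp_rw [h1]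
      exact (integrable_exp_mul_abs_mul_gaussian _).const_mul _
    · have := (NormedSpace.expSeries_div_hasSum_exp (𝔸 := ℂ) (c * v)).mul_right (F v)
      rwa [← Complex.exp_eq_exp_ℂ] at this
  have hinv := hFc.fourierInv_fourier_eq hFi (by rw [hzero]; exact integrable_zero _ _ _)
  rw [hzero] at hinv
  have hx : F x = 0 := by
    rw [← hinv]
    simp [Real.fourierInv_eq']
  have hne : hermiteFn 0 x ≠ 0 := by
    rw [hermiteFn]
    have := Real.pi_pos
    positivity
  rw [hF, Complex.ofReal_eq_zero] at hx
  exact (mul_eq_zero.1 hx).resolve_right hne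

theorem abel_coeff_le (n : ℕ) :
    √((n : ℝ) + 1) * (1 / (2 * n + 1) - 1 / (2 * n + 3))
      ≤ 4 * (1 / √((n : ℝ) + 1) - 1 / √((n : ℝ) + 2)) := by
  have hn0 : (0 : ℝ) ≤ n := Nat.cast_nonneg n
  have h1 : 0 < √((n : ℝ) + 1) := by positivity
  have h2 : 0 < √((n : ℝ) + 2) := by positivity
  have s1 : √((n : ℝ) + 1) ^ 2 = n + 1 := Real.sq_sqrt (by positivity)
  have s2 : √((n : ℝ) + 2) ^ 2 = n + 2 := Real.sq_sqrt (by positivity)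
  have h3 : √((n : ℝ) + 1) ≤ √((n : ℝ) + 2) := Real.sqrt_le_sqrt (by linarith)
  set a := √((n : ℝ) + 1)
  set b := √((n : ℝ) + 2)
  have e : (n : ℝ) = a ^ 2 - 1 := by linarith
  have e2 : b ^ 2 = a ^ 2 + 1 := by linarith
  have h5 : 1 ≤ a := by
    have : 1 ≤ a ^ 2 := by linarith
    nlinarith
  have h4 : b - a = 1 / (b + a) := by
    rw [eq_div_iff (by positivity)]; nlinarith
  have hl : a * (1 / (2 * n + 1) - 1 / (2 * n + 3)) = 2 * a / ((2 * a ^ 2 - 1) * (2 * a ^ 2 + 1)) := by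
    rw [e, show 2 * (a ^ 2 - 1) + 1 = 2 * a ^ 2 - 1 by ring,
      show 2 * (a ^ 2 - 1) + 3 = 2 * a ^ 2 + 1 by ring]
    have p : 2 * a ^ 2 - 1 ≠ 0 := by nlinarith
    have q : 2 * a ^ 2 + 1 ≠ 0 := by nlinarith
    rw [div_sub_div _ _ p q, mul_div_assoc']
    ring
  have hr : 4 * (1 / a - 1 / b) = 4 / (a * b * (b + a)) := by
    have : 1 / a - 1 / b = (b - a) / (a * b) := by field_simp
    rw [this, h4]; field_simp
  rw [hl, hr, div_le_div_iff₀ (by have : 0 < 2 * a ^ 2 - 1 := by nlinarith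
                                  positivity) (by positivity)]
  have h6 : b ≤ 3 / 2 * a := by nlinarith
  have h7 : b * (b + a) ≤ 3 / 2 * a * (5 / 2 * a) := by
    apply mul_le_mul h6 (by linarith) (by positivity) (by positivity)
  have h8 : 2 * a * (a * b * (b + a)) ≤ 2 * a ^ 2 * (3 / 2 * a * (5 / 2 * a)) := by
    have : 0 ≤ 2 * a ^ 2 := by positivity
    nlinarith
  nlinarith [sq_nonneg (a ^ 2 - 1), mul_pos h1 h1]

theorem christoffel_le_sqrt (n : ℕ) (x : ℝ) : christoffel n x ≤ √((n : ℝ) + 1) := by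
  refine (christoffel_le n x).trans ?_
  rw [div_le_iff₀ Real.pi_pos]
  have := gammaTerm_le n
  have h3 := Real.pi_gt_three
  nlinarith [Real.sqrt_nonneg ((n : ℝ) + 1)]

/-- A uniform bound for the diagonal of the Green kernel `∑ h_k(x) h_k(y) / (2k + 1)`. -/
theorem sum_hermiteFn_sq_div_le (n : ℕ) (x : ℝ) :
    ∑ k ∈ Finset.range n, hermiteFn k x ^ 2 / (2 * k + 1) ≤ 5 := by
  have key : ∀ n : ℕ, ∑ k ∈ Finset.range (n + 1), hermiteFn k x ^ 2 / (2 * k + 1)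
      ≤ christoffel n x / (2 * n + 1) + 4 * (1 - 1 / √((n : ℝ) + 1)) := by
    intro n
    induction n with
    | zero => simp [christoffel]
    | succ n ih =>
      rw [Finset.sum_range_succ, christoffel_succ]
      have h1 := abel_coeff_le n
      have h2 := christoffel_le_sqrt n x
      have h3 : 0 ≤ (1 / (2 * (n : ℝ) + 1) - 1 / (2 * n + 3)) := by
        rw [sub_nonneg]
        exact one_div_le_one_div_of_le (by positivity) (by linarith)
      have h4 := mul_le_mul_of_nonneg_right h2 h3
      push_cast
      rw [show 2 * ((n : ℝ) + 1) + 1 = 2 * n + 3 by ring, show (n : ℝ) + 1 + 1 = n + 2 by ring,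
        add_div]
      rw [div_eq_mul_one_div (christoffel n x)] at ih ⊢
      nlinarith
  have hle : ∑ k ∈ Finset.range n, hermiteFn k x ^ 2 / (2 * k + 1)
      ≤ ∑ k ∈ Finset.range (n + 1), hermiteFn k x ^ 2 / (2 * k + 1) := by
    rw [Finset.sum_range_succ]
    have : 0 ≤ hermiteFn n x ^ 2 / (2 * n + 1) := by positivity
    linarith
  refine (hle.trans (key n)).trans ?_
  have h1 : christoffel n x / (2 * n + 1) ≤ 1 := by
    rw [div_le_one (by positivity)]
    refine (christoffel_le_sqrt n x).trans ?_
    rw [Real.sqrt_le_left (by positivity)]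
    nlinarith [(Nat.cast_nonneg n : (0 : ℝ) ≤ n)]
  have h2 : 0 ≤ 1 / √((n : ℝ) + 1) := by positivity
  linarith

section

theorem exists_seq_of_set_choice {α : Type*} (Q : Set α → α → Prop)
    (h : ∀ s, ∃ y, Q s y) : ∃ f : ℕ → α, ∀ n, Q (f '' Set.Iio n) (f n) := by
  choose y hy using h
  let F : (n : ℕ) → ((m : ℕ) → m < n → α) → α := fun n g =>
    y {a | ∃ (m : ℕ) (hm : m < n), g m hm = a}
  refine ⟨Nat.lt_wfRel.wf.fix F, fun n => ?_⟩
  have e : Nat.lt_wfRel.wf.fix F n = y (Nat.lt_wfRel.wf.fix F '' Set.Iio n) := by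
    rw [WellFounded.fix_eq]
    simp only [F]
    congr 1
    ext a
    simp only [Set.mem_ofPred_eq, Set.mem_image, Set.mem_Iio, exists_prop]
  rw [e]
  exact hy _

variable {E : Type*} [NormedAddCommGroup E] [InnerProductSpace ℝ E] [CompleteSpace E]

theorem hasEigenvalue_norm {T : E →L[ℝ] E} (hT : IsCompactOperator T)
    (hs : (T : E →ₗ[ℝ] E).IsSymmetric) (hpos : ∀ x, 0 ≤ inner ℝ (T x) x) (h0 : T ≠ 0) :
    Module.End.HasEigenvalue (T : Module.End ℝ E) ‖T‖ := by
  have hn : ‖T‖ ≠ 0 := norm_ne_zero_iff.2 h0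
  have : Nontrivial E := by
    by_contra h
    rw [not_nontrivial_iff_subsingleton] at h
    exact h0 (Subsingleton.elim _ _)
  by_contra hne
  have hr := (hT.hasEigenvalue_or_mem_resolventSet hn).resolve_left hne
  obtain ⟨ε, hε, hle⟩ := T.rayleighQuotient_le_of_norm_mem_resolventSet (𝕜 := ℝ) hr
  have h1 := T.norm_eq_iSup_rayleighQuotient hs
  have h2 : ⨆ x, |T.rayleighQuotient x| ≤ ‖T‖ - ε := by
    refine ciSup_le fun x => ?_
    rw [abs_of_nonneg]
    · exact hle x
    · exact div_nonneg (by simpa [ContinuousLinearMap.reApplyInnerSelf] using hpos x)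
        (by positivity)
  linarith

theorem exists_eigenvector_orthogonal (hE : ¬ FiniteDimensional ℝ E) {S : E →L[ℝ] E}
    (hS : IsCompactOperator S)
    (hs : (S : E →ₗ[ℝ] E).IsSymmetric) (hpos : ∀ x, x ≠ 0 → 0 < inner ℝ (S x) x)
    {s : Set E} (hfin : s.Finite) (heig : ∀ x ∈ s, ∃ c : ℝ, S x = c • x) :
    ∃ y, ‖y‖ = 1 ∧ (∀ x ∈ s, inner ℝ x y = 0) ∧ ∃ c > 0, S y = c • y ∧
      ∀ z, (∀ x ∈ s, inner ℝ x z = 0) → inner ℝ (S z) z ≤ c * ‖z‖ ^ 2 := by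
  set W := (Submodule.span ℝ s)ᗮ with hW
  have hmem : ∀ z, z ∈ W ↔ ∀ x ∈ s, inner ℝ x z = 0 := by
    intro z
    rw [hW, Submodule.mem_orthogonal]
    refine ⟨fun h x hx => h x (Submodule.subset_span hx), fun h x hx => ?_⟩
    induction hx using Submodule.span_induction with
    | mem x hx => exact h x hx
    | zero => simp
    | add x y _ _ hx hy => rw [inner_add_left, hx, hy, add_zero]
    | smul c x _ hx => rw [inner_smul_left, hx, mul_zero]
  have hinv : ∀ z ∈ W, S z ∈ W := by
    intro z hz
    rw [hmem] at hz ⊢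
    intro x hx
    obtain ⟨c, hc⟩ := heig x hx
    have h1 : inner ℝ (S x) z = inner ℝ x (S z) := hs x z
    rw [← h1, hc, inner_smul_left, hz x hx, mul_zero]
  have hnt : Nontrivial W := by
    by_contra h
    rw [not_nontrivial_iff_subsingleton, Submodule.subsingleton_iff_eq_bot] at h
    have : FiniteDimensional ℝ (Submodule.span ℝ s) := FiniteDimensional.span_of_finite ℝ hfin
    rw [hW, Submodule.orthogonal_eq_bot_iff] at h
    rw [h] at this
    exact hE (Module.finite_def.2 (Module.Finite.iff_fg.1 this))
  have hclosed : IsClosed (W : Set E) := Submodule.isClosed_orthogonal _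
  have : CompleteSpace W := hclosed.completeSpace_coe
  let T : W →L[ℝ] W := S.restrict hinv
  have hTS : ∀ z : W, ((T z : W) : E) = S z := fun z => rfl
  have hTc : IsCompactOperator T := IsCompactOperator.restrict' (f := (S : E →ₗ[ℝ] E)) hS hinv
  have hTs : (T : W →ₗ[ℝ] W).IsSymmetric := fun x y => hs x y
  have hTpos : ∀ x, x ≠ 0 → 0 < inner ℝ (T x) x := fun x hx => hpos x (by simpa using hx)
  have hTn : ∀ x, 0 ≤ inner ℝ (T x) x := fun x => by
    rcases eq_or_ne x 0 with rfl | hx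
    · simp
    · exact (hTpos x hx).le
  have hT0 : T ≠ 0 := by
    obtain ⟨x, hx⟩ := exists_ne (0 : W)
    intro h
    have := hTpos x hx
    simp [h] at this
  obtain ⟨v, hv, hv0⟩ := (hasEigenvalue_norm hTc hTs hTn hT0).exists_hasEigenvector
  have hv : T v = ‖T‖ • v := Module.End.mem_eigenspace_iff.1 hv
  have hvn : ‖v‖ ≠ 0 := norm_ne_zero_iff.2 hv0
  refine ⟨‖v‖⁻¹ • (v : E), ?_, ?_, ‖T‖, by positivity, ?_, ?_⟩
  · rw [norm_smul, norm_inv, norm_norm]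
    exact inv_mul_cancel₀ hvn
  · intro x hx
    rw [inner_smul_right, (hmem _).1 v.2 x hx, mul_zero]
  · rw [map_smul, ← hTS, hv, Submodule.coe_smul, smul_comm]
  · intro z hz
    have h1 := real_inner_le_norm (T ⟨z, (hmem z).2 hz⟩) ⟨z, (hmem z).2 hz⟩
    have h2 := T.le_opNorm ⟨z, (hmem z).2 hz⟩
    have h3 : inner ℝ (S z) z = inner ℝ (T ⟨z, (hmem z).2 hz⟩) ⟨z, (hmem z).2 hz⟩ := rfl
    rw [h3]
    have h4 : ‖(⟨z, (hmem z).2 hz⟩ : W)‖ = ‖z‖ := rfl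
    rw [h4] at h1 h2
    nlinarith [norm_nonneg z]

/-- A sorted eigenbasis of a compact positive definite operator on an infinite-dimensional
Hilbert space. -/
theorem exists_sorted_eigenbasis (hE : ¬ FiniteDimensional ℝ E) {S : E →L[ℝ] E}
    (hS : IsCompactOperator S)
    (hs : (S : E →ₗ[ℝ] E).IsSymmetric) (hpos : ∀ x, x ≠ 0 → 0 < inner ℝ (S x) x) :
    ∃ (ψ : ℕ → E) (c : ℕ → ℝ), Orthonormal ℝ ψ ∧ Antitone c ∧ (∀ n, 0 < c n) ∧
      (∀ n, S (ψ n) = c n • ψ n) ∧ (∀ x, (∀ n, inner ℝ (ψ n) x = 0) → x = 0) ∧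
      ∀ ε > 0, ∃ n, c n < ε := by
  obtain ⟨ψ, hψ⟩ := exists_seq_of_set_choice (α := E)
    (fun s y => s.Finite → (∀ x ∈ s, ∃ c : ℝ, S x = c • x) →
      ‖y‖ = 1 ∧ (∀ x ∈ s, inner ℝ x y = 0) ∧ ∃ c > 0, S y = c • y ∧
      ∀ z, (∀ x ∈ s, inner ℝ x z = 0) → inner ℝ (S z) z ≤ c * ‖z‖ ^ 2)
    (fun s => by
      by_cases h : s.Finite ∧ ∀ x ∈ s, ∃ c : ℝ, S x = c • x
      · obtain ⟨y, hy⟩ := exists_eigenvector_orthogonal hE hS hs hpos h.1 h.2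
        exact ⟨y, fun _ _ => hy⟩
      · exact ⟨0, fun h1 h2 => (h ⟨h1, h2⟩).elim⟩)
  have heig : ∀ n, ∃ c : ℝ, S (ψ n) = c • ψ n := by
    intro n
    induction n using Nat.strong_induction_on with
    | _ n ih =>
      obtain ⟨_, _, c, _, h, _⟩ := hψ n ((Set.finite_Iio n).image ψ) (by
        rintro _ ⟨m, hm, rfl⟩; exact ih m hm)
      exact ⟨c, h⟩
  have hψ' := fun n => hψ n ((Set.finite_Iio n).image ψ) (by rintro _ ⟨m, hm, rfl⟩; exact heig m)
  choose h1 h2 c hc0 hc hmax using hψ'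
  have horth : ∀ m n, m < n → inner ℝ (ψ m) (ψ n) = 0 := fun m n hmn =>
    h2 n _ ⟨m, hmn, rfl⟩
  have hon : Orthonormal ℝ ψ := by
    refine ⟨h1, fun m n hmn => ?_⟩
    rcases lt_or_gt_of_ne hmn with h | h
    · exact horth m n h
    · rw [real_inner_comm]; exact horth n m h
  have hanti : Antitone c := by
    refine antitone_nat_of_succ_le fun n => ?_
    have := hmax n (ψ (n + 1)) (by
      rintro _ ⟨m, hm, rfl⟩
      exact horth m (n + 1) (Nat.lt_succ_of_lt hm))
    rw [hc, inner_smul_left, real_inner_self_eq_norm_sq, h1] at this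
    simpa using this
  have hsmall : ∀ ε > 0, ∃ n, c n < ε := by
    intro ε hε
    by_contra! hge
    obtain ⟨K, hK, hKS⟩ := IsCompactOperator.image_closedBall_subset_compact
      (f := (S : E →ₗ[ℝ] E)) hS 1
    have hmemK : ∀ n, S (ψ n) ∈ K := fun n => hKS ⟨ψ n, by simp [h1], rfl⟩
    obtain ⟨a, _, φ, hφ, hlim⟩ := hK.tendsto_subseq hmemK
    obtain ⟨N, hN⟩ := Metric.cauchySeq_iff.1 hlim.cauchySeq ε hε
    have hd := hN (N + 1) (by omega) N le_rfl
    have hne : φ N < φ (N + 1) := hφ (Nat.lt_succ_self N)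
    simp only [Function.comp, dist_eq_norm] at hd
    have hsq : ‖S (ψ (φ (N + 1))) - S (ψ (φ N))‖ ^ 2 = c (φ (N + 1)) ^ 2 + c (φ N) ^ 2 := by
      rw [@norm_sub_sq_real, hc, hc, norm_smul, norm_smul, h1, h1, inner_smul_left,
        inner_smul_right, real_inner_comm, horth _ _ hne]
      simp
    have g1 := hge (φ N)
    have g2 := hc0 (φ (N + 1))
    nlinarith [norm_nonneg (S (ψ (φ (N + 1))) - S (ψ (φ N)))]
  refine ⟨ψ, c, hon, hanti, hc0, hc, fun x hx => ?_, hsmall⟩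
  by_contra hne
  have hp := hpos x hne
  have hxn : 0 < ‖x‖ ^ 2 := by positivity
  obtain ⟨n, hn⟩ := hsmall _ (div_pos hp hxn)
  have := hmax n x (by rintro _ ⟨m, hm, rfl⟩; exact hx m)
  rw [lt_div_iff₀ hxn] at hn
  linarith

theorem rank_ker_one_sub_smul {F : Type} [NormedAddCommGroup F] [InnerProductSpace ℝ F] {S : F →L[ℝ] F} (hs : (S : F →ₗ[ℝ] F).IsSymmetric)
    {ψ : ℕ → F} {lam : ℕ → ℝ} (hψ : Orthonormal ℝ ψ) (hmono : Monotone lam)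
    (hunb : ∀ M, ∃ n, M < lam n) (heig : ∀ n, ψ n = lam n • S (ψ n))
    (hcompl : ∀ x, (∀ n, inner ℝ (ψ n) x = 0) → x = 0) (μ : ℝ) :
    Module.rank ℝ (LinearMap.ker ((LinearMap.id : F →ₗ[ℝ] F) - μ • (S : F →ₗ[ℝ] F)))
      = Cardinal.mk {k : ℕ // lam k = μ} := by
  set K := LinearMap.ker ((LinearMap.id : F →ₗ[ℝ] F) - μ • (S : F →ₗ[ℝ] F)) with hK
  have hmem : ∀ x, x ∈ K ↔ x = μ • S x := by
    intro x; rw [hK, LinearMap.mem_ker]; simp [sub_eq_zero]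
  have hfin : Finite {k : ℕ // lam k = μ} := by
    obtain ⟨n, hn⟩ := hunb μ
    refine Set.Finite.to_subtype ((Set.finite_Iio n).subset fun k hk => ?_)
    by_contra h
    have h' : lam n ≤ lam k := hmono (not_lt.1 h)
    have hk : lam k = μ := hk
    linarith
  have := Fintype.ofFinite {k : ℕ // lam k = μ}
  let v : {k : ℕ // lam k = μ} → K := fun k => ⟨ψ k.1, (hmem _).2 (by
    conv_lhs => rw [heig, k.2])⟩
  have hvE : ∀ k, ((v k : K) : F) = ψ k.1 := fun k => rfl
  have hli : LinearIndependent ℝ v := by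
    have h1 : LinearIndependent ℝ (fun k : {k : ℕ // lam k = μ} => ψ k.1) :=
      hψ.linearIndependent.comp _ Subtype.val_injective
    exact LinearIndependent.of_comp K.subtype h1
  have hsp : ⊤ ≤ Submodule.span ℝ (Set.range v) := by
    rintro ⟨x, hx⟩ -
    have hx' := (hmem x).1 hx
    have e : (⟨x, hx⟩ : K) = ∑ k, inner ℝ (ψ k.1) x • v k := by
      apply Subtype.ext
      rw [Submodule.coe_sum, ← sub_eq_zero]
      refine hcompl _ fun n => ?_
      simp only [Submodule.coe_smul, hvE]
      rw [inner_sub_right, inner_sum]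
      simp only [inner_smul_right]
      by_cases hn : lam n = μ
      · rw [Finset.sum_eq_single (⟨n, hn⟩ : {k : ℕ // lam k = μ})]
        · rw [real_inner_self_eq_norm_sq, hψ.1]; simp
        · intro b _ hb
          rw [hψ.2 (fun h => hb (Subtype.ext h.symm)), mul_zero]
        · simp
      · rw [Finset.sum_eq_zero, sub_zero]
        · have h1 : inner ℝ (S (ψ n)) x = inner ℝ (ψ n) (S x) := hs _ _
          have h2 : inner ℝ (ψ n) x = lam n * inner ℝ (ψ n) (S x) := by
            conv_lhs => rw [heig n]
            rw [inner_smul_left, h1]; rfl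
          have h3 : inner ℝ (ψ n) x = μ * inner ℝ (ψ n) (S x) := by
            conv_lhs => rw [hx']
            rw [inner_smul_right]
          have h4 : (lam n - μ) * inner ℝ (ψ n) (S x) = 0 := by linarith
          rw [h2, (mul_eq_zero.1 h4).resolve_left (sub_ne_zero.2 hn), mul_zero]
        · intro b _
          rw [hψ.2 (fun h => hn (by rw [h]; exact b.2)), mul_zero]
    rw [e]
    exact Submodule.sum_mem _ fun k _ => Submodule.smul_mem _ _ (Submodule.subset_span ⟨k, rfl⟩)
  exact (Module.Basis.mk hli hsp).mk_eq_rank''.symm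

theorem sum_le_of_weights {lam p : ℕ → ℝ} (hmono : Monotone lam) (hp0 : ∀ j, 0 ≤ p j)
    (hp1 : ∀ j, p j ≤ 1) {n : ℕ} (hp : HasSum p (n + 1)) {A : ℝ}
    (hA : ∀ M, ∑ j ∈ Finset.range M, lam j * p j ≤ A) :
    ∑ j ∈ Finset.range (n + 1), lam j ≤ A := by
  have h1 : ∀ M, n + 1 ≤ M → ∑ j ∈ Finset.range (n + 1), lam j
      + lam n * (∑ j ∈ Finset.range M, p j - (n + 1)) ≤ A := by
    intro M hM
    refine le_trans ?_ (hA M)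
    have e1 : ∑ j ∈ Finset.range (n + 1), (lam j - lam n)
        ≤ ∑ j ∈ Finset.range (n + 1), (lam j - lam n) * p j := by
      refine Finset.sum_le_sum fun j hj => ?_
      have : lam j ≤ lam n := hmono (by simpa [Nat.lt_succ_iff] using hj)
      nlinarith [hp1 j]
    have e2 : ∑ j ∈ Finset.range (n + 1), (lam j - lam n) * p j
        ≤ ∑ j ∈ Finset.range M, (lam j - lam n) * p j := by
      refine Finset.sum_le_sum_of_subset_of_nonneg (Finset.range_mono hM) fun j _ hj => ?_
      have : lam n ≤ lam j := hmono (by simp at hj; omega)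
      exact mul_nonneg (by linarith) (hp0 j)
    have e3 := e1.trans e2
    simp only [sub_mul, Finset.sum_sub_distrib, Finset.sum_const, Finset.card_range,
      nsmul_eq_mul, ← Finset.mul_sum] at e3
    push_cast at e3
    linarith
  have h2 : Tendsto (fun M => ∑ j ∈ Finset.range (n + 1), lam j
      + lam n * (∑ j ∈ Finset.range M, p j - (n + 1))) atTop
      (nhds (∑ j ∈ Finset.range (n + 1), lam j + lam n * ((n + 1) - (n + 1)))) :=
    ((hp.tendsto_sum_nat.sub_const _).const_mul _).const_add _
  have h3 := le_of_tendsto h2 (eventually_atTop.2 ⟨n + 1, h1⟩)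
  simpa using h3

/-- The variational principle for the sum of the lowest eigenvalues, for the generalized
eigenvalue problem `T φ = lam D² φ` in terms of `ψ = D φ`. -/
theorem sum_eigenvalues_le {T D : E →L[ℝ] E} (hT : (T : E →ₗ[ℝ] E).IsSymmetric)
    (hTpos : ∀ x, 0 ≤ inner ℝ (T x) x) (hD : (D : E →ₗ[ℝ] E).IsSymmetric)
    {ψ φ : ℕ → E} {lam : ℕ → ℝ} (hψ : Orthonormal ℝ ψ) (hmono : Monotone lam)
    (hcompl : ∀ x, (∀ n, inner ℝ (ψ n) x = 0) → x = 0)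
    (hφ : ∀ n, D (φ n) = ψ n) (hTφ : ∀ n, T (φ n) = lam n • D (ψ n))
    {b : ℕ → E} (hb : Orthonormal ℝ (fun k => D (b k))) (n : ℕ) :
    ∑ j ∈ Finset.range (n + 1), lam j
      ≤ ∑ k ∈ Finset.range (n + 1), inner ℝ (T (b k)) (b k) := by
  have hDs : ∀ x y, inner ℝ (D x) y = inner ℝ x (D y) := fun x y => hD x y
  have hTs : ∀ x y, inner ℝ (T x) y = inner ℝ x (T y) := fun x y => hT x y
  have bessel : ∀ x M, ∑ j ∈ Finset.range M, lam j * inner ℝ (ψ j) (D x) ^ 2 ≤ inner ℝ (T x) x := by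
    intro x M
    set y := ∑ j ∈ Finset.range M, inner ℝ (ψ j) (D x) • φ j with hy
    have h1 : T y = ∑ j ∈ Finset.range M, (inner ℝ (ψ j) (D x) * lam j) • D (ψ j) := by
      rw [hy, map_sum]
      refine Finset.sum_congr rfl fun j _ => ?_
      rw [map_smul, hTφ, smul_smul]
    have h2 : inner ℝ (T y) x = ∑ j ∈ Finset.range M, lam j * inner ℝ (ψ j) (D x) ^ 2 := by
      rw [h1, sum_inner]
      refine Finset.sum_congr rfl fun j _ => ?_
      rw [inner_smul_left, hDs]
      simp only [conj_trivial]
      ring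
    have h3 : inner ℝ (T y) y = ∑ j ∈ Finset.range M, lam j * inner ℝ (ψ j) (D x) ^ 2 := by
      rw [h1, sum_inner]
      refine Finset.sum_congr rfl fun j hj => ?_
      have e : inner ℝ (ψ j) (D y) = inner ℝ (ψ j) (D x) := by
        rw [hy, map_sum, inner_sum, Finset.sum_eq_single j]
        · rw [map_smul, hφ, inner_smul_right, real_inner_self_eq_norm_sq, hψ.1]; simp
        · intro i _ hij
          rw [map_smul, hφ, inner_smul_right, hψ.2 hij.symm, mul_zero]
        · exact fun h => (h hj).elim
      rw [inner_smul_left, hDs, e]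
      simp only [conj_trivial]
      ring
    have h4 := hTpos (x - y)
    have h5 : inner ℝ (T x) y = inner ℝ (T y) x := by rw [hTs, real_inner_comm]
    rw [map_sub, inner_sub_left, inner_sub_right, inner_sub_right, h5, h3, h2] at h4
    linarith
  let B : HilbertBasis ℕ ℝ E := HilbertBasis.mkOfOrthogonalEqBot hψ (by
    rw [Submodule.eq_bot_iff]
    intro x hx
    exact hcompl x fun m => (Submodule.mem_orthogonal _ _).1 hx _ (Submodule.subset_span ⟨m, rfl⟩))
  have hB : ∀ j, B j = ψ j := fun j => by simp [B]
  refine sum_le_of_weights (p := fun j => ∑ k ∈ Finset.range (n + 1), inner ℝ (ψ j) (D (b k)) ^ 2)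
    hmono (fun j => Finset.sum_nonneg fun k _ => sq_nonneg _) (fun j => ?_) ?_ (fun M => ?_)
  · have := hb.sum_inner_products_le (ψ j) (s := Finset.range (n + 1))
    rw [hψ.1] at this
    simpa [real_inner_comm] using this
  · have h1 : ∀ k ∈ Finset.range (n + 1), HasSum (fun j => inner ℝ (ψ j) (D (b k)) ^ 2) 1 := by
      intro k _
      have := B.hasSum_inner_mul_inner (D (b k)) (D (b k))
      rw [real_inner_self_eq_norm_sq, hb.1] at this
      simpa [hB, real_inner_comm, sq] using this
    have := hasSum_sum h1
    simpa using this
  · simp_rw [Finset.mul_sum]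
    rw [Finset.sum_comm]
    exact Finset.sum_le_sum fun k _ => bessel _ _

/-- Two monotone lists whose fibres have the same cardinalities coincide. -/
theorem eq_of_monotone_of_mk_fiber_eq {f g : ℕ → ℝ} (hf : Monotone f) (hg : Monotone g)
    (h : ∀ μ, Cardinal.mk {k : ℕ // f k = μ} = Cardinal.mk {k : ℕ // g k = μ}) : f = g := by
  have key : ∀ {f g : ℕ → ℝ}, Monotone f → Monotone g →
      (∀ μ, Cardinal.mk {k : ℕ // f k = μ} = Cardinal.mk {k : ℕ // g k = μ}) →
      ∀ n, g n ≤ f n := by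
    intro f g hf hg h n
    have e : ∀ μ, {k : ℕ // f k = μ} ≃ {k : ℕ // g k = μ} := fun μ =>
      (Cardinal.eq.1 (h μ)).some
    let σ : ℕ → ℕ := fun k => (e (f k) ⟨k, rfl⟩).1
    have hσ : ∀ k, g (σ k) = f k := fun k => (e (f k) ⟨k, rfl⟩).2
    have hinj : Function.Injective σ := by
      intro a b hab
      have hfab : f a = f b := by rw [← hσ a, ← hσ b, hab]
      have h2 : ∀ (μ : ℝ) (x y : {k : ℕ // f k = μ}), (e μ x).1 = (e μ y).1 → x = y :=
        fun μ x y hxy => (e μ).injective (Subtype.ext hxy)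
      have h3 : ∀ (μ : ℝ) (hμ : f a = μ), (e μ ⟨a, hμ⟩).1 = σ a := by
        rintro _ rfl; rfl
      have := h2 (f b) ⟨a, hfab⟩ ⟨b, rfl⟩ ((h3 _ hfab).trans hab)
      exact congrArg Subtype.val this
    obtain ⟨i, hi, hni⟩ : ∃ i ∈ Finset.range (n + 1), n ≤ σ i := by
      by_contra! hlt
      have := Finset.card_le_card_of_injOn σ (s := Finset.range (n + 1)) (t := Finset.range n)
        (fun i hi => by simpa using hlt i hi) hinj.injOn
      simp at this
    calc g n ≤ g (σ i) := hg hni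
      _ = f i := hσ i
      _ ≤ f n := hf (by simpa [Nat.lt_succ_iff] using hi)
  funext n
  exact le_antisymm (key hg hf (fun μ => (h μ).symm) n) (key hf hg h n)

end

/-- The Hilbert space of real square-summable sequences. -/
abbrev SeqSpace : Type := lp (fun _ : ℕ => ℝ) 2

theorem SeqSpace.hasSum_inner (a b : SeqSpace) : HasSum (fun k => a k * b k) (inner ℝ a b) := by
  have := lp.hasSum_inner (𝕜 := ℝ) a b
  simpa [mul_comm] using this

theorem SeqSpace.hasSum_sq (a : SeqSpace) : HasSum (fun k => a k ^ 2) (‖a‖ ^ 2) := by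
  have := SeqSpace.hasSum_inner a a
  rw [real_inner_self_eq_norm_sq] at this
  simpa [sq] using this

theorem SeqSpace.norm_sq_le {a : SeqSpace} {C : ℝ}
    (h : ∀ n, ∑ k ∈ Finset.range n, a k ^ 2 ≤ C) : ‖a‖ ^ 2 ≤ C :=
  le_of_tendsto' (SeqSpace.hasSum_sq a).tendsto_sum_nat h

theorem SeqSpace.sum_sq_le (a : SeqSpace) (n : ℕ) :
    ∑ k ∈ Finset.range n, a k ^ 2 ≤ ‖a‖ ^ 2 :=
  sum_le_hasSum _ (fun _ _ => sq_nonneg _) (SeqSpace.hasSum_sq a)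

theorem memℓp_two_of_sum_sq_le {f : ℕ → ℝ} {C : ℝ}
    (h : ∀ n, ∑ k ∈ Finset.range n, f k ^ 2 ≤ C) : Memℓp f 2 := by
  refine memℓp_gen ?_
  refine summable_of_sum_range_le (c := C) (fun k => by positivity) fun n => ?_
  refine le_trans (le_of_eq ?_) (h n)
  refine Finset.sum_congr rfl fun k _ => ?_
  simp

/-- The weights `(2k + 1)^{-1/2}`. -/
def weight (k : ℕ) : ℝ := 1 / √(2 * k + 1)

theorem weight_pos (k : ℕ) : 0 < weight k := by unfold weight; positivity

theorem weight_sq (k : ℕ) : weight k ^ 2 = 1 / (2 * k + 1) := by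
  unfold weight
  rw [div_pow, one_pow, Real.sq_sqrt (by positivity)]

theorem weight_anti {j k : ℕ} (h : j ≤ k) : weight k ≤ weight j := by
  have : (j : ℝ) ≤ k := Nat.cast_le.2 h
  exact one_div_le_one_div_of_le (by positivity) (Real.sqrt_le_sqrt (by linarith))

theorem weight_le_one (k : ℕ) : weight k ≤ 1 := by
  simpa [weight] using weight_anti (Nat.zero_le k)

theorem tendsto_weight : Tendsto weight atTop (nhds 0) := by
  have h : Tendsto (fun k : ℕ => 2 * (k : ℝ) + 1) atTop atTop :=
    tendsto_atTop_add_const_right _ _ (tendsto_natCast_atTop_atTop.const_mul_atTop two_pos)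
  have := (Real.tendsto_sqrt_atTop.comp h).inv_tendsto_atTop
  refine this.congr fun k => ?_
  simp [weight]

/-- Multiplication by a bounded sequence. -/
def diagonal (c : ℕ → ℝ) (M : ℝ) (hM : 0 ≤ M) (hc : ∀ k, |c k| ≤ M) : SeqSpace →L[ℝ] SeqSpace :=
  LinearMap.mkContinuous
    { toFun := fun a => ⟨fun k => c k * a k, memℓp_two_of_sum_sq_le (C := M ^ 2 * ‖a‖ ^ 2) fun n => by
        refine le_trans ?_ (mul_le_mul_of_nonneg_left (a.sum_sq_le n) (sq_nonneg M))
        rw [Finset.mul_sum]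
        refine Finset.sum_le_sum fun k _ => ?_
        rw [mul_pow]
        exact mul_le_mul_of_nonneg_right (sq_le_sq' (abs_le.1 (hc k)).1 (abs_le.1 (hc k)).2)
          (sq_nonneg _)⟩
      map_add' := fun a b => by
        ext k; exact mul_add _ _ _
      map_smul' := fun r a => by
        ext k; exact mul_left_comm _ _ _ } M (fun a => by
      refine le_of_sq_le_sq ?_ (by positivity)
      refine SeqSpace.norm_sq_le fun n => ?_
      rw [mul_pow]
      refine le_trans ?_ (mul_le_mul_of_nonneg_left (a.sum_sq_le n) (sq_nonneg M))
      rw [Finset.mul_sum]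
      refine Finset.sum_le_sum fun k _ => ?_
      show (c k * a k) ^ 2 ≤ _
      rw [mul_pow]
      exact mul_le_mul_of_nonneg_right (sq_le_sq' (abs_le.1 (hc k)).1 (abs_le.1 (hc k)).2)
          (sq_nonneg _))

/-- The operator with diagonal entries `(2k + 1)^{-1/2}`. -/
def opD : SeqSpace →L[ℝ] SeqSpace :=
  diagonal weight 1 zero_le_one fun k => by
    rw [abs_of_pos (weight_pos k)]; exact weight_le_one k

theorem opD_apply (a : SeqSpace) (k : ℕ) : opD a k = weight k * a k := rfl

theorem opD_symm : (opD : SeqSpace →ₗ[ℝ] SeqSpace).IsSymmetric := by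
  intro a b
  refine (SeqSpace.hasSum_inner (opD a) b).unique ?_
  refine (SeqSpace.hasSum_inner a (opD b)).congr_fun ?_
  intro k
  rw [opD_apply, opD_apply]; ring

theorem opD_eq_zero {a : SeqSpace} (h : opD a = 0) : a = 0 := by
  ext k
  have : opD a k = 0 := by rw [h]; rfl
  rw [opD_apply] at this
  exact (mul_eq_zero.1 this).resolve_left (weight_pos k).ne'

theorem opD_compact : IsCompactOperator opD := by
  let F : ℕ → SeqSpace →L[ℝ] SeqSpace := fun N => ∑ k ∈ Finset.range N,
    weight k • ((lp.singleContinuousLinearMap ℝ (fun _ : ℕ => ℝ) 2 k).comp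
      (lp.evalCLM ℝ (fun _ : ℕ => ℝ) 2 k))
  have hF : ∀ N a j, F N a j = if j < N then weight j * a j else 0 := by
    intro N a j
    induction N with
    | zero => simp [F]
    | succ N ih =>
      have e : F (N + 1) = F N + weight N • ((lp.singleContinuousLinearMap ℝ (fun _ : ℕ => ℝ) 2 N).comp
        (lp.evalCLM ℝ (fun _ : ℕ => ℝ) 2 N)) := Finset.sum_range_succ _ _
      have e2 : F (N + 1) a j = F N a j + weight N * (lp.single (E := fun _ : ℕ => ℝ) 2 N (a N)) j := by
        rw [e]; rfl
      rw [e2, ih]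
      rcases eq_or_ne j N with rfl | hj
      · rw [lp.single_apply_self]; simp
      · rw [lp.single_apply_ne _ _ _ hj]
        have : j < N + 1 ↔ j < N := by omega
        simp [this]
  have hc : ∀ N, IsCompactOperator (F N) := by
    intro N
    have : F N ∈ compactOperator (RingHom.id ℝ) SeqSpace SeqSpace := by
      refine Submodule.sum_mem _ fun k _ => Submodule.smul_mem _ _ ?_
      have h : IsCompactOperator (lp.evalCLM ℝ (fun _ : ℕ => ℝ) 2 k) :=
        isCompactOperator_of_locallyCompactSpace_dom _
      exact h.clm_comp (lp.singleContinuousLinearMap ℝ (fun _ : ℕ => ℝ) 2 k)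
    exact this
  refine isCompactOperator_of_tendsto (l := atTop) (F := F) ?_ (Eventually.of_forall hc)
  rw [tendsto_iff_norm_sub_tendsto_zero]
  refine squeeze_zero (fun _ => norm_nonneg _) (fun N => ?_) tendsto_weight
  refine ContinuousLinearMap.opNorm_le_bound _ (weight_pos N).le fun a => ?_
  refine le_of_sq_le_sq ?_ (mul_nonneg (weight_pos N).le (norm_nonneg _))
  refine SeqSpace.norm_sq_le fun n => ?_
  rw [mul_pow]
  refine le_trans ?_ (mul_le_mul_of_nonneg_left (a.sum_sq_le n) (sq_nonneg (weight N)))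
  rw [Finset.mul_sum]
  refine Finset.sum_le_sum fun k _ => ?_
  have : ((F N - opD) a) k = F N a k - opD a k := rfl
  rw [this, hF, opD_apply]
  split_ifs with h
  · rw [sub_self]; simp only [ne_eq, OfNat.ofNat_ne_zero, not_false_eq_true, zero_pow]; positivity
  · rw [zero_sub, neg_sq, mul_pow]
    exact mul_le_mul_of_nonneg_right
      (pow_le_pow_left₀ (weight_pos k).le (weight_anti (not_lt.1 h)) 2) (sq_nonneg _)

/-- The standard unit vectors. -/
def unit (k : ℕ) : SeqSpace := lp.single 2 k 1

theorem inner_unit (k : ℕ) (a : SeqSpace) : inner ℝ (unit k) a = a k := by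
  rw [unit, lp.inner_single_left]; simp

theorem unit_apply (k j : ℕ) : unit k j = if k = j then 1 else 0 := by
  split_ifs with h
  · rw [h, unit, lp.single_apply_self]
  · rw [unit, lp.single_apply_ne _ _ _ (Ne.symm h)]

theorem orthonormal_unit : Orthonormal ℝ unit := by
  rw [orthonormal_iff_ite]
  intro i j
  rw [inner_unit, unit_apply]
  simp [eq_comm]

theorem not_finiteDimensional_seqSpace : ¬ FiniteDimensional ℝ SeqSpace := by
  intro h
  have := orthonormal_unit.linearIndependent.finite
  exact not_finite ℕ

theorem SeqSpace.hasSum_unit (a : SeqSpace) : HasSum (fun k => a k • unit k) a := by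
  have := lp.hasSum_single (p := 2) (by simp) a
  refine this.congr_fun fun k => ?_
  ext j
  rw [unit, lp.coeFn_smul, Pi.smul_apply, smul_eq_mul]
  rcases eq_or_ne j k with rfl | h
  · rw [lp.single_apply_self, lp.single_apply_self, mul_one]
  · rw [lp.single_apply_ne _ _ _ h, lp.single_apply_ne _ _ _ h, mul_zero]

/-- The vector representing the evaluation at `x` on the form domain of the oscillator. -/
def evalVec (x : ℝ) : SeqSpace :=
  ⟨fun k => weight k * hermiteFn k x, memℓp_two_of_sum_sq_le (C := 5) fun n => by
    refine le_trans (le_of_eq ?_) (sum_hermiteFn_sq_div_le n x)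
    refine Finset.sum_congr rfl fun k _ => ?_
    rw [mul_pow, weight_sq]; ring⟩

theorem evalVec_apply (x : ℝ) (k : ℕ) : evalVec x k = weight k * hermiteFn k x := rfl

theorem norm_evalVec_le (x : ℝ) : ‖evalVec x‖ ≤ 3 := by
  have : ‖evalVec x‖ ^ 2 ≤ 5 := by
    refine SeqSpace.norm_sq_le fun n => ?_
    refine le_trans (le_of_eq ?_) (sum_hermiteFn_sq_div_le n x)
    refine Finset.sum_congr rfl fun k _ => ?_
    rw [evalVec_apply, mul_pow, weight_sq]; ring
  nlinarith [norm_nonneg (evalVec x)]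

theorem stronglyMeasurable_evalVec : StronglyMeasurable evalVec := by
  refine stronglyMeasurable_of_tendsto atTop
    (f := fun N x => ∑ k ∈ Finset.range N, evalVec x k • unit k) (fun N => ?_) ?_
  · refine Continuous.stronglyMeasurable ?_
    refine continuous_finsetSum _ fun k _ => ?_
    exact ((continuous_hermiteFn k).const_mul (weight k)).smul continuous_const
  · rw [tendsto_pi_nhds]
    exact fun x => (SeqSpace.hasSum_unit (evalVec x)).tendsto_sum_nat

/-- The function `∑ (2k + 1)^{-1/2} b_k h_k`. -/
def synth (b : SeqSpace) (x : ℝ) : ℝ := inner ℝ (evalVec x) b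

theorem abs_synth_le (b : SeqSpace) (x : ℝ) : |synth b x| ≤ 3 * ‖b‖ :=
  (abs_real_inner_le_norm _ _).trans
    (mul_le_mul_of_nonneg_right (norm_evalVec_le x) (norm_nonneg b))

theorem hasSum_synth (b : SeqSpace) (x : ℝ) :
    HasSum (fun k => b k * weight k * hermiteFn k x) (synth b x) := by
  refine (SeqSpace.hasSum_inner (evalVec x) b).congr_fun fun k => ?_
  rw [evalVec_apply]; ring

theorem synth_unit (k : ℕ) (x : ℝ) : synth (unit k) x = weight k * hermiteFn k x := by
  rw [synth, real_inner_comm, inner_unit, evalVec_apply]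

theorem synth_add (a b : SeqSpace) (x : ℝ) : synth (a + b) x = synth a x + synth b x :=
  inner_add_right _ _ _

theorem synth_smul (c : ℝ) (a : SeqSpace) (x : ℝ) : synth (c • a) x = c * synth a x :=
  inner_smul_right _ _ _

theorem synth_sub (a b : SeqSpace) (x : ℝ) : synth (a - b) x = synth a x - synth b x :=
  inner_sub_right _ _ _

theorem synth_sum (b : SeqSpace) (N : ℕ) (x : ℝ) :
    synth (∑ k ∈ Finset.range N, b k • unit k) x
      = ∑ k ∈ Finset.range N, b k * weight k * hermiteFn k x := by
  rw [synth, inner_sum]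
  refine Finset.sum_congr rfl fun k _ => ?_
  rw [inner_smul_right, real_inner_comm, inner_unit, evalVec_apply]; ring

theorem continuous_synth (b : SeqSpace) : Continuous (synth b) := by
  have h : TendstoUniformly
      (fun N x => synth (∑ k ∈ Finset.range N, b k • unit k) x) (synth b) atTop := by
    rw [Metric.tendstoUniformly_iff]
    intro ε hε
    have := (SeqSpace.hasSum_unit b).tendsto_sum_nat
    rw [Metric.tendsto_nhds] at this
    filter_upwards [this (ε / 3) (by positivity)] with N hN x
    rw [Real.dist_eq, ← synth_sub]
    rw [dist_comm, dist_eq_norm] at hN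
    linarith [abs_synth_le (b - ∑ k ∈ Finset.range N, b k • unit k) x]
  refine h.continuous (Frequently.of_forall fun N => ?_)
  simp_rw [synth_sum]
  refine continuous_finsetSum _ fun k _ => ?_
  exact (continuous_hermiteFn k).const_mul _

/-- The vector `∫ f(x) · evalVec x dx`. -/
def coeffVec (f : ℝ → ℝ) : SeqSpace := ∫ x, f x • evalVec x

theorem integrable_smul_evalVec {f : ℝ → ℝ} (hf : Integrable f) :
    Integrable (fun x => f x • evalVec x) :=
  hf.smul_bdd 3 stronglyMeasurable_evalVec.aestronglyMeasurable
    (Eventually.of_forall norm_evalVec_le)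

theorem inner_coeffVec {f : ℝ → ℝ} (hf : Integrable f) (a : SeqSpace) :
    inner ℝ (coeffVec f) a = ∫ x, f x * synth a x := by
  rw [coeffVec, real_inner_comm, ← integral_inner (integrable_smul_evalVec hf)]
  refine integral_congr_ae (Eventually.of_forall fun x => ?_)
  simp only [inner_smul_right, synth, real_inner_comm]

theorem coeffVec_apply {f : ℝ → ℝ} (hf : Integrable f) (k : ℕ) :
    coeffVec f k = weight k * ∫ x, f x * hermiteFn k x := by
  rw [← inner_unit, real_inner_comm, inner_coeffVec hf, ← integral_const_mul]
  refine integral_congr_ae (Eventually.of_forall fun x => ?_)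
  simp only [synth_unit]; ring

theorem integral_synth_mul_hermiteFn (b : SeqSpace) (k : ℕ) :
    ∫ x, synth b x * hermiteFn k x = weight k * b k := by
  have h := inner_coeffVec (isRapid_hermiteFn k).integrable b
  have e : coeffVec (hermiteFn k) = weight k • unit k := by
    ext j
    rw [coeffVec_apply (isRapid_hermiteFn k).integrable, integral_hermiteFn_mul, lp.coeFn_smul,
      Pi.smul_apply, unit_apply]
    split_ifs with h
    · simp [h]
    · simp
  rw [e, inner_smul_left, inner_unit] at h
  simp only [conj_trivial] at h
  rw [h]
  simp_rw [mul_comm]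

theorem integrable_mul_synth {q : ℝ → ℝ} (hq : Integrable q) (b : SeqSpace) :
    Integrable (fun x => q x * synth b x) :=
  hq.mul_bdd (c := 3 * ‖b‖) (continuous_synth b).aestronglyMeasurable
    (Eventually.of_forall (abs_synth_le b))

/-- The operator of the perturbation `q` relative to the form of the oscillator. -/
def opB (q : ℝ → ℝ) (hq : Integrable q) : SeqSpace →L[ℝ] SeqSpace :=
  LinearMap.mkContinuous
    { toFun := fun a => coeffVec (fun x => q x * synth a x)
      map_add' := fun a b => by
        simp only [coeffVec]
        rw [← integral_add (integrable_smul_evalVec (integrable_mul_synth hq a))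
          (integrable_smul_evalVec (integrable_mul_synth hq b))]
        simp only [synth_add, mul_add, add_smul]
      map_smul' := fun c a => by
        simp only [coeffVec, RingHom.id_apply]
        rw [← integral_smul]
        simp only [synth_smul, mul_left_comm _ c, smul_smul] } ((∫ x, |q x|) * 9) (fun a => by
      refine (norm_integral_le_of_norm_le (hq.abs.mul_const (9 * ‖a‖))
        (Eventually.of_forall fun x => ?_)).trans (le_of_eq ?_)
      · rw [norm_smul, Real.norm_eq_abs, abs_mul, mul_assoc]
        refine mul_le_mul_of_nonneg_left ?_ (abs_nonneg _)
        calc |synth a x| * ‖evalVec x‖ ≤ (3 * ‖a‖) * 3 :=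
              mul_le_mul (abs_synth_le a x) (norm_evalVec_le x) (norm_nonneg _) (by positivity)
          _ = 9 * ‖a‖ := by ring
      · rw [integral_mul_const]; ring)

theorem opB_apply (q : ℝ → ℝ) (hq : Integrable q) (a : SeqSpace) :
    opB q hq a = coeffVec (fun x => q x * synth a x) := rfl

theorem inner_opB (q : ℝ → ℝ) (hq : Integrable q) (a b : SeqSpace) :
    inner ℝ (opB q hq a) b = ∫ x, q x * synth a x * synth b x := by
  rw [opB_apply, inner_coeffVec (integrable_mul_synth hq a)]

/-- The operator of the form of `-d²/dx² + x² + q` relative to that of the oscillator. -/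
def opT (q : ℝ → ℝ) (hq : Integrable q) : SeqSpace →L[ℝ] SeqSpace := 1 + opB q hq

theorem opT_apply (q : ℝ → ℝ) (hq : Integrable q) (a : SeqSpace) :
    opT q hq a = a + coeffVec (fun x => q x * synth a x) := rfl

theorem opT_symm (q : ℝ → ℝ) (hq : Integrable q) :
    (opT q hq : SeqSpace →ₗ[ℝ] SeqSpace).IsSymmetric := by
  intro a b
  show inner ℝ (a + opB q hq a) b = inner ℝ a (b + opB q hq b)
  rw [inner_add_left, inner_add_right, real_inner_comm (opB q hq b) a, inner_opB, inner_opB]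
  simp only [mul_assoc, mul_comm (synth a _)]

theorem inner_opT_self (q : ℝ → ℝ) (hq : Integrable q) (a : SeqSpace) :
    inner ℝ (opT q hq a) a = ‖a‖ ^ 2 + ∫ x, q x * synth a x ^ 2 := by
  show inner ℝ (a + opB q hq a) a = _
  rw [inner_add_left, inner_opB, real_inner_self_eq_norm_sq]
  simp only [mul_assoc, sq]

theorem norm_sq_le_inner_opT {q : ℝ → ℝ} (hq : Integrable q) (hq0 : ∀ᵐ x, 0 ≤ q x) (a : SeqSpace) :
    ‖a‖ ^ 2 ≤ inner ℝ (opT q hq a) a := by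
  rw [inner_opT_self]
  have : 0 ≤ ∫ x, q x * synth a x ^ 2 := by
    refine integral_nonneg_of_ae ?_
    filter_upwards [hq0] with x hx
    exact mul_nonneg hx (sq_nonneg _)
  linarith

theorem isUnit_opT {q : ℝ → ℝ} (hq : Integrable q) (hq0 : ∀ᵐ x, 0 ≤ q x) :
    IsUnit (opT q hq) := by
  refine ContinuousLinearMap.isUnit_of_forall_le_norm_inner_map (𝕜 := ℝ) _ (c := 1) zero_lt_one
    fun a => ?_
  rw [NNReal.coe_one, mul_one, Real.norm_eq_abs]
  exact (norm_sq_le_inner_opT hq hq0 a).trans (le_abs_self _)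

/-- The inverse of `opT`. -/
def opR (q : ℝ → ℝ) (hq : Integrable q) : SeqSpace →L[ℝ] SeqSpace := Ring.inverse (opT q hq)

theorem opT_opR {q : ℝ → ℝ} (hq : Integrable q) (hq0 : ∀ᵐ x, 0 ≤ q x) (a : SeqSpace) :
    opT q hq (opR q hq a) = a :=
  DFunLike.congr_fun (Ring.mul_inverse_cancel _ (isUnit_opT hq hq0)) a

theorem opR_opT {q : ℝ → ℝ} (hq : Integrable q) (hq0 : ∀ᵐ x, 0 ≤ q x) (a : SeqSpace) :
    opR q hq (opT q hq a) = a :=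
  DFunLike.congr_fun (Ring.inverse_mul_cancel _ (isUnit_opT hq hq0)) a

/-- The inverse of `-d²/dx² + x² + q` in the basis of Hermite functions. -/
def opS (q : ℝ → ℝ) (hq : Integrable q) : SeqSpace →L[ℝ] SeqSpace :=
  opD.comp ((opR q hq).comp opD)

theorem opS_apply (q : ℝ → ℝ) (hq : Integrable q) (a : SeqSpace) :
    opS q hq a = opD (opR q hq (opD a)) := rfl

theorem opS_compact (q : ℝ → ℝ) (hq : Integrable q) : IsCompactOperator (opS q hq) :=
  opD_compact.comp_clm _

theorem inner_opS {q : ℝ → ℝ} (hq : Integrable q) (hq0 : ∀ᵐ x, 0 ≤ q x) (a b : SeqSpace) :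
    inner ℝ (opS q hq a) b
      = inner ℝ (opR q hq (opD a)) (opT q hq (opR q hq (opD b))) := by
  rw [opT_opR hq hq0, opS_apply]
  exact opD_symm _ _

theorem opS_symm {q : ℝ → ℝ} (hq : Integrable q) (hq0 : ∀ᵐ x, 0 ≤ q x) :
    (opS q hq : SeqSpace →ₗ[ℝ] SeqSpace).IsSymmetric := by
  intro a b
  have h1 := inner_opS hq hq0 a b
  have h2 := inner_opS hq hq0 b a
  have h3 : inner ℝ (opT q hq (opR q hq (opD b))) (opR q hq (opD a))
    = inner ℝ (opR q hq (opD b)) (opT q hq (opR q hq (opD a))) := opT_symm q hq _ _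
  show inner ℝ (opS q hq a) b = inner ℝ a (opS q hq b)
  rw [h1, real_inner_comm, h3, ← h2, real_inner_comm]

theorem opS_pos {q : ℝ → ℝ} (hq : Integrable q) (hq0 : ∀ᵐ x, 0 ≤ q x) (a : SeqSpace)
    (ha : a ≠ 0) : 0 < inner ℝ (opS q hq a) a := by
  rw [inner_opS hq hq0, real_inner_comm]
  refine lt_of_lt_of_le ?_ (norm_sq_le_inner_opT hq hq0 _)
  have : opR q hq (opD a) ≠ 0 := by
    intro h
    have h2 := opT_opR hq hq0 (opD a)
    rw [h, map_zero] at h2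
    exact ha (opD_eq_zero h2.symm)
  have := norm_pos_iff.2 this
  positivity

/-- The eigenvalue data of the perturbed oscillator in the basis of Hermite functions. -/
theorem exists_eigenvalues_opS {q : ℝ → ℝ} (hq : Integrable q) (hq0 : ∀ᵐ x, 0 ≤ q x) :
    ∃ lam : ℕ → ℝ, Monotone lam ∧
      (∀ μ : ℝ, Module.rank ℝ (LinearMap.ker ((LinearMap.id : SeqSpace →ₗ[ℝ] SeqSpace)
        - μ • (opS q hq : SeqSpace →ₗ[ℝ] SeqSpace))) = Cardinal.mk {k : ℕ // lam k = μ}) ∧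
      ∀ n, ∑ j ∈ Finset.range (n + 1), lam j
        ≤ ∑ k ∈ Finset.range (n + 1), (2 * k + 1 + ∫ x, q x * hermiteFn k x ^ 2) := by
  obtain ⟨ψ, c, hon, hanti, hc0, hc, hcompl, hsmall⟩ := exists_sorted_eigenbasis
    not_finiteDimensional_seqSpace (opS_compact q hq) (opS_symm hq hq0) (opS_pos hq hq0)
  have hmono : Monotone fun n => (c n)⁻¹ := fun m n hmn => inv_anti₀ (hc0 n) (hanti hmn)
  have heig : ∀ n, ψ n = (c n)⁻¹ • opS q hq (ψ n) := fun n => by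
    rw [hc, smul_smul, inv_mul_cancel₀ (hc0 n).ne', one_smul]
  refine ⟨fun n => (c n)⁻¹, hmono, fun μ => ?_, fun n => ?_⟩
  · refine rank_ker_one_sub_smul (opS_symm hq hq0) hon hmono (fun M => ?_) heig hcompl μ
    obtain ⟨n, hn⟩ := hsmall (|M| + 1)⁻¹ (by positivity)
    refine ⟨n, ?_⟩
    have := (lt_inv_comm₀ (hc0 n) (by positivity)).1 hn
    linarith [le_abs_self M]
  · have hDb : ∀ k, opD ((weight k)⁻¹ • unit k) = unit k := by
      intro k
      ext j
      rw [map_smul, lp.coeFn_smul, Pi.smul_apply, opD_apply, unit_apply, smul_eq_mul]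
      split_ifs with h
      · rw [← h, mul_one, inv_mul_cancel₀ (weight_pos k).ne']
      · simp
    refine (sum_eigenvalues_le (opT_symm q hq)
      (fun x => (sq_nonneg _).trans (norm_sq_le_inner_opT hq hq0 x)) opD_symm
      (φ := fun n => (c n)⁻¹ • opR q hq (opD (ψ n))) hon hmono hcompl (fun n => ?_) (fun n => ?_)
      (b := fun k => (weight k)⁻¹ • unit k) ?_ n).trans (le_of_eq ?_)
    · rw [map_smul]; exact (heig n).symm
    · rw [map_smul, opT_opR hq hq0]
    · simp_rw [hDb]; exact orthonormal_unit
    · refine Finset.sum_congr rfl fun k _ => ?_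
      rw [inner_opT_self, norm_smul, orthonormal_unit.1, mul_one, Real.norm_eq_abs, sq_abs,
        inv_pow, weight_sq, one_div, inv_inv]
      congr 2
      ext x
      rw [synth_smul, synth_unit, ← mul_assoc, inv_mul_cancel₀ (weight_pos k).ne', one_mul]

theorem continuous_of_absolutelyContinuous {f : ℝ → ℝ}
    (hf : ∀ a b, AbsolutelyContinuousOnInterval f a b) : Continuous f := by
  rw [continuous_iff_continuousAt]
  intro x
  refine (hf (x - 1) (x + 1)).continuousOn.continuousAt ?_
  rw [Set.uIcc_of_le (by linarith)]
  exact Icc_mem_nhds (by linarith) (by linarith)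

theorem absolutelyContinuous_of_continuous_deriv {f : ℝ → ℝ} (hf : Differentiable ℝ f)
    (hf' : Continuous (deriv f)) (a b : ℝ) : AbsolutelyContinuousOnInterval f a b :=
  (contDiff_one_iff_deriv.2 ⟨hf, hf'⟩).contDiffOn.absolutelyContinuousOnInterval

theorem expBounded_of_deriv {f r : ℝ → ℝ} {A : ℝ} (hf : ∀ a b, AbsolutelyContinuousOnInterval f a b)
    (hr : Integrable r) (hA : 0 ≤ A)
    (h : ∀ᵐ x, |deriv f x| ≤ A * Real.exp |x| + |r x|) : ExpBounded f := by
  have hint : ∀ a b : ℝ, IntervalIntegrable (fun x => A * Real.exp |x| + |r x|) volume a b :=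
    fun a b => (Continuous.intervalIntegrable (by fun_prop) a b).add hr.abs.intervalIntegrable
  have hexp : ∀ a b : ℝ, IntervalIntegrable (fun x => A * Real.exp |x|) volume a b :=
    fun a b => Continuous.intervalIntegrable (by fun_prop) a b
  have hr' : ∀ a b : ℝ, a ≤ b → ∫ t in a..b, |r t| ≤ ∫ t, |r t| := by
    intro a b hab
    rw [intervalIntegral.integral_of_le hab]
    exact setIntegral_le_integral hr.abs (Eventually.of_forall fun x => abs_nonneg _)
  have key : ∀ a b : ℝ, a ≤ b → |f b - f a| ≤ (∫ t in a..b, A * Real.exp |t|) + ∫ t, |r t| := by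
    intro a b hab
    rw [← (hf a b).integral_deriv_eq_sub, ← Real.norm_eq_abs]
    refine (intervalIntegral.norm_integral_le_of_norm_le (f := deriv f) hab (h.mono fun t ht _ => ht)
      (hint a b)).trans ?_
    rw [intervalIntegral.integral_add (hexp a b) hr.abs.intervalIntegrable]
    linarith [hr' a b hab]
  have hI : 0 ≤ ∫ t, |r t| := integral_nonneg fun t => abs_nonneg _
  refine ⟨|f 0| + A + ∫ t, |r t|, fun x => ?_⟩
  have h1 : 1 ≤ Real.exp |x| := Real.one_le_exp (abs_nonneg x)
  have main : |f x - f 0| ≤ A * Real.exp |x| + ∫ t, |r t| := by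
    rcases le_total 0 x with hx | hx
    · refine (key 0 x hx).trans ?_
      have e : ∫ t in (0 : ℝ)..x, A * Real.exp |t| = A * (Real.exp x - Real.exp 0) := by
        rw [intervalIntegral.integral_const_mul, ← integral_exp]
        congr 1
        refine intervalIntegral.integral_congr fun t ht => ?_
        rw [Set.uIcc_of_le hx] at ht
        simp only [abs_of_nonneg ht.1]
      rw [e, abs_of_nonneg hx]
      nlinarith [Real.exp_pos (0 : ℝ)]
    · rw [abs_sub_comm]
      refine (key x 0 hx).trans ?_
      have e : ∫ t in x..(0 : ℝ), A * Real.exp |t| = A * (Real.exp (-x) - Real.exp 0) := by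
        rw [intervalIntegral.integral_const_mul]
        congr 1
        have : ∫ t in x..(0 : ℝ), Real.exp |t| = ∫ t in x..(0 : ℝ), Real.exp (-t) := by
          refine intervalIntegral.integral_congr fun t ht => ?_
          rw [Set.uIcc_of_le hx] at ht
          simp only [abs_of_nonpos ht.2]
        rw [this, intervalIntegral.integral_comp_neg (fun t => Real.exp t), integral_exp, neg_zero]
      rw [e, abs_of_nonpos hx]
      nlinarith [Real.exp_pos (0 : ℝ)]
  have h2 : |f x| ≤ |f x - f 0| + |f 0| := by
    have := abs_add_le (f x - f 0) (f 0); simpa using this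
  nlinarith [abs_nonneg (f 0)]

theorem expBounded_of_deriv_deriv {w r : ℝ → ℝ} {A : ℝ} (hw : Differentiable ℝ w)
    (hw' : ∀ a b, AbsolutelyContinuousOnInterval (deriv w) a b) (hr : Integrable r) (hA : 0 ≤ A)
    (h : ∀ᵐ x, |deriv (deriv w) x| ≤ A * Real.exp |x| + |r x|) : ExpBounded w := by
  obtain ⟨B, hB0, hB⟩ := (expBounded_of_deriv hw' hr hA h).exists_nonneg
  exact expBounded_of_deriv
    (absolutelyContinuous_of_continuous_deriv hw (continuous_of_absolutelyContinuous hw'))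
    (integrable_zero ℝ ℝ volume) hB0 (Eventually.of_forall fun x => by simpa using hB x)

/-- Integration by parts against a Hermite function. -/
theorem integral_mul_deriv_deriv_hermiteFn {w r : ℝ → ℝ} {A : ℝ} (hw : Differentiable ℝ w)
    (hw' : ∀ a b, AbsolutelyContinuousOnInterval (deriv w) a b) (hr : Integrable r) (hA : 0 ≤ A)
    (h : ∀ᵐ x, |deriv (deriv w) x| ≤ A * Real.exp |x| + |r x|) (k : ℕ) :
    ∫ x, w x * ((x ^ 2 - (2 * k + 1)) * hermiteFn k x)
      = ∫ x, deriv (deriv w) x * hermiteFn k x := by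
  have hw'b : ExpBounded (deriv w) := expBounded_of_deriv hw' hr hA h
  have hw'c : Continuous (deriv w) := continuous_of_absolutelyContinuous hw'
  have hwac := absolutelyContinuous_of_continuous_deriv hw hw'c
  have hwb : ExpBounded w := expBounded_of_deriv_deriv hw hw' hr hA h
  have hk1 := (contDiff_hermiteFn k).of_le (show (1 : WithTop ℕ∞) ≤ 2 by norm_num)
  have hkac : ∀ a b, AbsolutelyContinuousOnInterval (hermiteFn k) a b := fun a b =>
    hk1.contDiffOn.absolutelyContinuousOnInterval
  have hk'ac : ∀ a b, AbsolutelyContinuousOnInterval (deriv (hermiteFn k)) a b := by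
    refine absolutelyContinuous_of_continuous_deriv
      (fun x => (hasDerivAt_deriv_hermiteFn k x).differentiableAt) ?_
    have : deriv (deriv (hermiteFn k)) = fun x => (x ^ 2 - (2 * k + 1)) * hermiteFn k x :=
      funext fun x => (hasDerivAt_deriv_hermiteFn k x).deriv
    rw [this]
    have := continuous_hermiteFn k
    fun_prop
  have hrap : IsRapid (fun x => (x ^ 2 - (2 * k + 1)) * hermiteFn k x) := by
    convert ((isRapid_hermiteFn k).pow_mul 2).sub ((isRapid_hermiteFn k).const_mul (2 * k + 1))
      using 2 with x
    ring
  have i1 : Integrable (fun x => w x * ((x ^ 2 - (2 * k + 1)) * hermiteFn k x)) :=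
    integrable_mul_of_rapid hw.continuous.aestronglyMeasurable hwb hrap
  have i2 : Integrable (fun x => deriv (deriv w) x * hermiteFn k x) := by
    have j1 : Integrable (fun x => A * Real.exp |x| * |hermiteFn k x|) := by
      have := (integrable_mul_of_rapid (m := fun x => A * Real.exp |x|) (by fun_prop)
        ⟨A, fun x => by rw [abs_of_nonneg (by positivity)]⟩ (isRapid_hermiteFn k)).abs
      refine this.congr (Eventually.of_forall fun x => ?_)
      simp only [abs_mul, abs_of_nonneg hA, abs_of_pos (Real.exp_pos _)]
    have j2 : Integrable (fun x => |r x| * |hermiteFn k x|) := by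
      simpa only [abs_mul] using (integrable_mul_of_rapid' hr (isRapid_hermiteFn k)).abs
    refine (j1.add j2).mono' ((measurable_deriv _).aestronglyMeasurable.mul
      (continuous_hermiteFn k).aestronglyMeasurable) ?_
    filter_upwards [h] with x hx
    rw [Real.norm_eq_abs, abs_mul]
    simp only [Pi.add_apply, ← add_mul]
    exact mul_le_mul_of_nonneg_right hx (abs_nonneg _)
  set F : ℝ → ℝ := fun x => w x * deriv (hermiteFn k) x - deriv w x * hermiteFn k x with hF
  have hFac : ∀ a b, AbsolutelyContinuousOnInterval F a b := fun a b =>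
    ((hwac a b).fun_mul (hk'ac a b)).sub ((hw' a b).fun_mul (hkac a b))
  have hFd : ∀ᵐ x, deriv F x = w x * ((x ^ 2 - (2 * k + 1)) * hermiteFn k x)
      - deriv (deriv w) x * hermiteFn k x := by
    filter_upwards [ae_differentiableAt_of_ac hw'] with x hx
    refine HasDerivAt.deriv ?_
    refine (((hw x).hasDerivAt.mul (hasDerivAt_deriv_hermiteFn k x)).sub
      (hx.hasDerivAt.mul (differentiable_hermiteFn k x).hasDerivAt)).congr_deriv ?_
    ring
  have hlim := intervalIntegral_tendsto_integral (i1.sub i2)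
    (tendsto_neg_atTop_atBot) (tendsto_id (α := ℝ) (x := atTop))
  have hval : ∀ R : ℝ, ∫ x in -R..R, (w x * ((x ^ 2 - (2 * k + 1)) * hermiteFn k x)
      - deriv (deriv w) x * hermiteFn k x) = F R - F (-R) := by
    intro R
    rw [← (hFac (-R) R).integral_deriv_eq_sub]
    refine intervalIntegral.integral_congr_ae ?_
    filter_upwards [hFd] with x hx _
    exact hx.symm
  have hF0 : Tendsto (fun R => F R - F (-R)) atTop (nhds 0) := by
    have t1 : Tendsto F atTop (nhds (0 - 0)) :=
      (tendsto_mul_of_rapid_atTop hwb (isRapid_deriv_hermiteFn k)).sub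
        (tendsto_mul_of_rapid_atTop hw'b (isRapid_hermiteFn k))
    have t2 : Tendsto F atBot (nhds (0 - 0)) :=
      (tendsto_mul_of_rapid_atBot hwb (isRapid_deriv_hermiteFn k)).sub
        (tendsto_mul_of_rapid_atBot hw'b (isRapid_hermiteFn k))
    simpa using t1.sub (t2.comp tendsto_neg_atTop_atBot)
  have h0 := tendsto_nhds_unique hlim (hF0.congr fun R => (hval R).symm)
  have h1 := integral_sub i1 i2
  simp only [Pi.sub_apply] at h0
  linarith

theorem le_of_integrable_of_monotoneOn_deriv {f : ℝ → ℝ} {R : ℝ} (hf : Differentiable ℝ f)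
    (hf0 : ∀ x, 0 ≤ f x) (hi : Integrable f) (hm : MonotoneOn (deriv f) (Set.Ici R)) {x : ℝ}
    (hx : R ≤ x) : f x ≤ f R := by
  have hneg : ∀ y, R ≤ y → deriv f y ≤ 0 := by
    intro y hy
    by_contra! hpos
    have hlow : ∀ z, y + 1 ≤ z → deriv f y ≤ f z := by
      intro z hz
      have := (convex_Ici y).mul_sub_le_image_sub_of_le_deriv hf.continuous.continuousOn
        hf.differentiableOn (C := deriv f y) (fun t ht => by
          rw [interior_Ici] at ht
          have ht : y < t := ht
          exact hm hy (hy.trans ht.le) ht.le) y Set.self_mem_Ici z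
          (show y ≤ z by linarith) (by linarith)
      nlinarith [hf0 y]
    have hc : IntegrableOn (fun _ : ℝ => deriv f y) (Set.Ici (y + 1)) := by
      refine Integrable.mono' hi.integrableOn (by fun_prop) ?_
      filter_upwards [ae_restrict_mem measurableSet_Ici] with z hz
      rw [Real.norm_eq_abs, abs_of_pos hpos]
      exact hlow z hz
    rw [integrableOn_const_iff] at hc
    simp [hpos.ne'] at hc
  refine antitoneOn_of_deriv_nonpos (convex_Ici R) hf.continuous.continuousOn
    hf.differentiableOn (fun y hy => ?_) Set.self_mem_Ici hx hx
  rw [interior_Ici] at hy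
  exact hneg y (le_of_lt hy)

/-- Square-integrable solutions are bounded. -/
theorem IsL2Solution.exists_bound {q : ℝ → ℝ} (hq0 : ∀ᵐ x, 0 ≤ q x) {μ : ℝ} {u : ℝ → ℝ}
    (hu : IsL2Solution q μ u) : ∃ M, ∀ x, |u x| ≤ M := by
  set R := |μ| + 1 with hR
  have hR1 : 1 ≤ R := by rw [hR]; linarith [abs_nonneg μ]
  have hu'c := continuous_of_absolutelyContinuous hu.absolutelyContinuous_deriv
  have huac := absolutelyContinuous_of_continuous_deriv hu.differentiable hu'c
  set f : ℝ → ℝ := fun x => u x ^ 2 with hf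
  have hfd : ∀ x, HasDerivAt f (2 * (u x * deriv u x)) x := by
    intro x
    refine ((hu.differentiable x).hasDerivAt.pow 2).congr_deriv ?_
    push_cast; ring
  have hfdiff : Differentiable ℝ f := fun x => (hfd x).differentiableAt
  have hfi : Integrable f :=
    (memLp_two_iff_integrable_sq hu.differentiable.continuous.aestronglyMeasurable).1 hu.memLp
  have hf' : deriv f = fun x => 2 * (u x * deriv u x) := funext fun x => (hfd x).deriv
  have hf'ac : ∀ a b, AbsolutelyContinuousOnInterval (deriv f) a b := by
    intro a b
    rw [hf']
    exact ((huac a b).fun_mul (hu.absolutelyContinuous_deriv a b)).const_mul 2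
  have hconv : ∀ᵐ x, R ≤ |x| → 0 ≤ deriv (deriv f) x := by
    filter_upwards [hu.equation, ae_differentiableAt_of_ac hu.absolutelyContinuous_deriv, hq0]
      with x h1 h2 h3 hx
    have e : deriv (deriv f) x = 2 * (deriv u x ^ 2 + (x ^ 2 + q x - μ) * u x ^ 2) := by
      rw [hf']
      have := ((hu.differentiable x).hasDerivAt.mul h2.hasDerivAt).const_mul 2
      refine (this.congr_deriv ?_).deriv
      have h4 : deriv (deriv u) x = (x ^ 2 + q x - μ) * u x := by linarith
      rw [h4]; ring
    rw [e]
    have h5 : μ ≤ x ^ 2 := by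
      have : |x| ≤ x ^ 2 := by rw [← sq_abs]; nlinarith
      linarith [le_abs_self μ]
    have h6 : 0 ≤ x ^ 2 + q x - μ := by linarith
    positivity
  have hmono : ∀ x y, x ≤ y → (∀ t ∈ Set.Icc x y, R ≤ |t|) → deriv f x ≤ deriv f y := by
    intro x y hxy ht
    have := (hf'ac x y).integral_deriv_eq_sub
    have h2 : 0 ≤ ∫ t in x..y, deriv (deriv f) t := by
      refine intervalIntegral.integral_nonneg_of_ae_restrict hxy ?_
      filter_upwards [ae_restrict_of_ae hconv, ae_restrict_mem measurableSet_Icc] with t h1 h2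
      exact h1 (ht t h2)
    linarith
  have hright : ∀ x, R ≤ x → f x ≤ f R := fun x hx =>
    le_of_integrable_of_monotoneOn_deriv hfdiff (fun x => sq_nonneg _) hfi
      (fun a ha b _ hab => hmono a b hab fun t ht => by
        have ha : R ≤ a := ha
        exact (ha.trans ht.1).trans (le_abs_self t)) hx
  have hleft : ∀ x, R ≤ x → f (-x) ≤ f (-R) := by
    intro x hx
    have hd : deriv (fun x => f (-x)) = fun x => -deriv f (-x) := by
      ext y; exact deriv_comp_neg f y
    refine le_of_integrable_of_monotoneOn_deriv (f := fun x => f (-x)) (hfdiff.comp differentiable_neg)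
      (fun x => sq_nonneg _) hfi.comp_neg (fun a ha b hb hab => ?_) hx
    rw [hd]
    refine neg_le_neg (hmono _ _ (neg_le_neg hab) fun t ht => ?_)
    have ha : R ≤ a := ha
    have : R ≤ -t := by linarith [ht.2]
    exact this.trans (neg_le_abs t)
  obtain ⟨C, hC⟩ := (isCompact_Icc (a := -R) (b := R)).exists_bound_of_continuousOn
    hfdiff.continuous.continuousOn
  have hfb : ∀ x, f x ≤ C := by
    intro x
    have hCR := (le_abs_self _).trans (hC R ⟨by linarith, le_rfl⟩)
    have hCR' := (le_abs_self _).trans (hC (-R) ⟨le_rfl, by linarith⟩)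
    rcases le_total R x with h | h
    · exact (hright x h).trans hCR
    · rcases le_total (-R) x with h' | h'
      · exact (le_abs_self _).trans (hC x ⟨h', h⟩)
      · have := hleft (-x) (by linarith)
        rw [neg_neg] at this
        exact this.trans hCR'
  exact ⟨√C, fun x => Real.abs_le_sqrt (hfb x)⟩

theorem abs_potential_mul_le {q u : ℝ → ℝ} {M : ℝ} (hM : ∀ x, |u x| ≤ M) (μ x : ℝ) :
    |(x ^ 2 + q x - μ) * u x| ≤ (2 + |μ|) * M * Real.exp |x| + |M * q x| := by
  have hM0 : 0 ≤ M := (abs_nonneg _).trans (hM 0)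
  have h1 : x ^ 2 ≤ 2 * Real.exp |x| := by
    have := Real.quadratic_le_exp_of_nonneg (abs_nonneg x)
    rw [sq_abs] at this
    linarith [abs_nonneg x]
  have h2 : 1 ≤ Real.exp |x| := Real.one_le_exp (abs_nonneg x)
  have h3 : |x ^ 2 + q x - μ| ≤ x ^ 2 + |q x| + |μ| := by
    refine (abs_sub _ _).trans (add_le_add ((abs_add_le _ _).trans ?_) le_rfl)
    rw [abs_of_nonneg (sq_nonneg x)]
  rw [abs_mul, abs_mul, abs_of_nonneg hM0]
  calc |x ^ 2 + q x - μ| * |u x| ≤ (x ^ 2 + |q x| + |μ|) * M :=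
        mul_le_mul h3 (hM x) (abs_nonneg _) (by positivity)
    _ ≤ ((2 + |μ|) * Real.exp |x| + |q x|) * M := by
        refine mul_le_mul_of_nonneg_right ?_ hM0
        nlinarith [abs_nonneg μ]
    _ = _ := by ring

/-- The weak form of the eigenvalue equation against Hermite functions. -/
theorem weak_form_iff {q u : ℝ → ℝ} (hq : Integrable q) (hu : Continuous u) {M : ℝ}
    (hM : ∀ x, |u x| ≤ M) (μ : ℝ) (k : ℕ) :
    (∫ x, u x * ((x ^ 2 - (2 * k + 1)) * hermiteFn k x))
        = (∫ x, (x ^ 2 + q x - μ) * u x * hermiteFn k x) ↔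
      (2 * k + 1) * (∫ x, u x * hermiteFn k x) + (∫ x, q x * u x * hermiteFn k x)
        = μ * (∫ x, u x * hermiteFn k x) := by
  have hub := ExpBounded.of_abs_le hM
  have i0 : Integrable (fun x => u x * hermiteFn k x) :=
    integrable_mul_of_rapid hu.aestronglyMeasurable hub (isRapid_hermiteFn k)
  have i1 : Integrable (fun x => u x * (x ^ 2 * hermiteFn k x)) :=
    integrable_mul_of_rapid hu.aestronglyMeasurable hub ((isRapid_hermiteFn k).pow_mul 2)
  have i2 : Integrable (fun x => q x * u x * hermiteFn k x) :=
    integrable_mul_of_rapid' (hq.mul_bdd (c := M) hu.aestronglyMeasurable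
      (Eventually.of_forall hM)) (isRapid_hermiteFn k)
  have e1 : (∫ x, u x * ((x ^ 2 - (2 * k + 1)) * hermiteFn k x))
      = (∫ x, u x * (x ^ 2 * hermiteFn k x)) - (2 * k + 1) * (∫ x, u x * hermiteFn k x) := by
    rw [← integral_const_mul, ← integral_sub i1 (i0.const_mul _)]
    refine integral_congr_ae (Eventually.of_forall fun x => ?_)
    simp only; ring
  have e2 : (∫ x, (x ^ 2 + q x - μ) * u x * hermiteFn k x)
      = (∫ x, u x * (x ^ 2 * hermiteFn k x)) + (∫ x, q x * u x * hermiteFn k x)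
        - μ * (∫ x, u x * hermiteFn k x) := by
    rw [← integral_const_mul, ← integral_add i1 i2, ← integral_sub (i1.fun_add i2) (i0.const_mul _)]
    refine integral_congr_ae (Eventually.of_forall fun x => ?_)
    simp only; ring
  rw [e1, e2]
  constructor <;> intro h <;> linarith

theorem four_mul_potential_mul_hermiteFn (k : ℕ) (x : ℝ) :
    4 * ((x ^ 2 - (2 * k + 1)) * hermiteFn k x)
      = ladder (k + 1) * ladder (k + 2) * hermiteFn (k + 2) x - (4 * k + 2) * hermiteFn k x
        + ladder k * ladder (k - 1) * hermiteFn (k - 2) x := by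
  have h0 := hermiteFn_recurrence k x
  have h1 := hermiteFn_recurrence (k + 1) x
  have s1 := ladder_sq (k + 1)
  cases k with
  | zero =>
    simp only [ladder_zero, Nat.add_sub_cancel] at *
    push_cast at *
    linear_combination 2 * x * h0 + ladder (0 + 1) * h1 + hermiteFn 0 x * s1
  | succ m =>
    have h2 := hermiteFn_recurrence m x
    have s0 := ladder_sq (m + 1)
    simp only [Nat.add_sub_cancel] at *
    push_cast at *
    linear_combination 2 * x * h0 + ladder (m + 1 + 1) * h1 + ladder (m + 1) * h2
      + hermiteFn (m + 1) x * s1 + hermiteFn (m + 1) x * s0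

/-- A function whose pairing with the range of the oscillator on Hermite functions vanishes is
determined by its first two Hermite coefficients. -/
theorem eq_zero_of_integral_mul_potential {z : ℝ → ℝ} (hz : Continuous z) (hb : ExpBounded z)
    (h : ∀ k : ℕ, ∫ x, z x * ((x ^ 2 - (2 * k + 1)) * hermiteFn k x) = 0)
    (h0 : ∫ x, z x * hermiteFn 0 x = 0) (h1 : ∫ x, z x * hermiteFn 1 x = 0) (x : ℝ) :
    z x = 0 := by
  refine eq_zero_of_integral_mul_hermiteFn hz hb (fun k => ?_) x
  have hi : ∀ k, Integrable (fun x => z x * hermiteFn k x) := fun k =>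
    integrable_mul_of_rapid hz.aestronglyMeasurable hb (isRapid_hermiteFn k)
  induction k using Nat.strong_induction_on with
  | _ k ih =>
    match k, ih with
    | 0, _ => exact h0
    | 1, _ => exact h1
    | m + 2, ih =>
      have e : ladder (m + 1) * ladder (m + 2) * (∫ x, z x * hermiteFn (m + 2) x)
          = 4 * (∫ x, z x * ((x ^ 2 - (2 * m + 1)) * hermiteFn m x))
            + (4 * m + 2) * (∫ x, z x * hermiteFn m x)
            - ladder m * ladder (m - 1) * (∫ x, z x * hermiteFn (m - 2) x) := by
        have hp : Integrable (fun x => z x * ((x ^ 2 - (2 * m + 1)) * hermiteFn m x)) := by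
          refine ((((hi (m + 2)).const_mul (ladder (m + 1) * ladder (m + 2))).sub
            ((hi m).const_mul (4 * m + 2))).add
            ((hi (m - 2)).const_mul (ladder m * ladder (m - 1)))).const_mul (1 / 4) |>.congr
            (Eventually.of_forall fun x => ?_)
          simp only [Pi.add_apply, Pi.sub_apply]
          linear_combination -(z x / 4) * four_mul_potential_mul_hermiteFn m x
        rw [← integral_const_mul, ← integral_const_mul, ← integral_const_mul, ← integral_const_mul,
          ← integral_add (hp.const_mul _) ((hi m).const_mul _),
          ← integral_sub ((hp.const_mul _).fun_add ((hi m).const_mul _)) ((hi (m - 2)).const_mul _)]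
        refine integral_congr_ae (Eventually.of_forall fun x => ?_)
        simp only
        linear_combination -z x * four_mul_potential_mul_hermiteFn m x
      rw [h, ih m (by omega), ih (m - 2) (by omega)] at e
      have hne : ladder (m + 1) * ladder (m + 2) ≠ 0 :=
        (mul_pos (ladder_succ_pos m) (ladder_succ_pos (m + 1))).ne'
      refine (mul_eq_zero.1 (e.trans ?_)).resolve_left hne
      ring

theorem exists_absolutelyContinuous_deriv_ae_eq {g : ℝ → ℝ}
    (hg : ∀ a b, IntervalIntegrable g volume a b) :
    ∃ v : ℝ → ℝ, (∀ a b, AbsolutelyContinuousOnInterval v a b) ∧ ∀ᵐ x, deriv v x = g x := by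
  refine ⟨fun x => ∫ t in (0 : ℝ)..x, g t, fun a b => ?_, ?_⟩
  · set R := max |a| |b| with hR
    have hR0 : 0 ≤ R := (abs_nonneg a).trans (le_max_left _ _)
    refine ((hg (-R) R).absolutelyContinuousOnInterval_intervalIntegral (c := 0) ?_).mono ?_
    · rw [Set.uIcc_of_le (by linarith)]; exact ⟨by linarith, hR0⟩
    · rw [Set.uIcc_of_le (show -R ≤ R by linarith)]
      refine Set.uIcc_subset_Icc (abs_le.1 (le_max_left _ _)) (abs_le.1 (le_max_right _ _))
  · have h : ∀ n : ℕ, ∀ᵐ x, x ∈ Set.uIcc (-(n : ℝ)) n →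
        deriv (fun x => ∫ t in (0 : ℝ)..x, g t) x = g x := by
      intro n
      filter_upwards [(hg (-(n : ℝ)) n).ae_hasDerivAt_integral] with x hx hxn
      refine (hx hxn 0 ?_).deriv
      rw [Set.uIcc_of_le (by linarith [n.cast_nonneg (α := ℝ)])]
      exact ⟨by simp, by simp⟩
    filter_upwards [ae_all_iff.2 h] with x hx
    obtain ⟨n, hn⟩ := exists_nat_ge |x|
    refine hx n ?_
    rw [Set.uIcc_of_le (by linarith [abs_nonneg x])]
    exact abs_le.1 hn

theorem hermiteFn_zero_neg (x : ℝ) : hermiteFn 0 (-x) = hermiteFn 0 x := by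
  simp [hermiteFn]

theorem hermiteFn_one_neg (x : ℝ) : hermiteFn 1 (-x) = -hermiteFn 1 x := by
  simp [hermiteFn]

theorem integral_eq_zero_of_odd {f : ℝ → ℝ} (hf : ∀ x, f (-x) = -f x) : ∫ x, f x = 0 := by
  have := integral_neg_eq_self f volume
  simp only [hf, integral_neg] at this
  linarith

theorem integral_hermiteFn_zero_pos : 0 < ∫ x, hermiteFn 0 x := by
  refine integral_pos_of_integrable_nonneg_nonzero (x := 0) (continuous_hermiteFn 0)
    (isRapid_hermiteFn 0).integrable (fun x => ?_) ?_
  · simp only [hermiteFn, Pi.zero_apply]; positivity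
  · simp only [hermiteFn]; positivity

theorem integral_mul_hermiteFn_one_pos : 0 < ∫ x, x * hermiteFn 1 x := by
  refine integral_pos_of_integrable_nonneg_nonzero (x := 1)
    (continuous_id.mul (continuous_hermiteFn 1))
    (isRapid_hermiteFn 1).id_mul.integrable (fun x => ?_) ?_
  · simp only [hermiteFn, Pi.zero_apply]
    rw [show x * (√2 * x * (√(1 / √Real.pi) * Real.exp (-x ^ 2 / 2)))
      = x ^ 2 * (√2 * (√(1 / √Real.pi) * Real.exp (-x ^ 2 / 2))) by ring]
    positivity
  · simp only [hermiteFn]; positivity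

/-- Weak solutions are regular. -/
theorem regularity_of_weak {q u : ℝ → ℝ} (hq : Integrable q) (hu : Continuous u) {M : ℝ}
    (hM : ∀ x, |u x| ≤ M) (μ : ℝ)
    (hweak : ∀ k : ℕ, (∫ x, u x * ((x ^ 2 - (2 * k + 1)) * hermiteFn k x))
        = ∫ x, (x ^ 2 + q x - μ) * u x * hermiteFn k x) :
    Differentiable ℝ u ∧ (∀ a b, AbsolutelyContinuousOnInterval (deriv u) a b) ∧
      ∀ᵐ x, deriv (deriv u) x = (x ^ 2 + q x - μ) * u x := by
  have hM0 : 0 ≤ M := (abs_nonneg _).trans (hM 0)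
  have hg : ∀ a b, IntervalIntegrable (fun x => (x ^ 2 + q x - μ) * u x) volume a b := by
    intro a b
    have h1 : IntervalIntegrable (fun x => (x ^ 2 - μ) * u x) volume a b :=
      Continuous.intervalIntegrable (by fun_prop) a b
    have h2 : IntervalIntegrable (fun x => q x * u x) volume a b :=
      (hq.mul_bdd (c := M) hu.aestronglyMeasurable (Eventually.of_forall hM)).intervalIntegrable
    refine (h1.add h2).congr fun x _ => ?_
    ring
  obtain ⟨v, hvac, hv⟩ := exists_absolutelyContinuous_deriv_ae_eq hg
  have hvc := continuous_of_absolutelyContinuous hvac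
  set W : ℝ → ℝ := fun x => ∫ t in (0 : ℝ)..x, v t with hW
  have hWd : ∀ x, HasDerivAt W (v x) x := fun x =>
    intervalIntegral.integral_hasDerivAt_right (hvc.intervalIntegrable _ _)
      (hvc.stronglyMeasurableAtFilter _ _) hvc.continuousAt
  have hbound : ∀ x, |(x ^ 2 + q x - μ) * u x| ≤ (2 + |μ|) * M * Real.exp |x| + |M * q x| :=
    abs_potential_mul_le hM μ
  have hA : 0 ≤ (2 + |μ|) * M := by positivity
  have hub := ExpBounded.of_abs_le hM
  set α := (∫ x, (u x - W x) * hermiteFn 0 x) / ∫ x, hermiteFn 0 x with hα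
  set β := (∫ x, (u x - W x) * hermiteFn 1 x) / ∫ x, x * hermiteFn 1 x with hβ
  set w : ℝ → ℝ := fun x => W x + α + β * x with hw
  have hwd : ∀ x, HasDerivAt w (v x + β) x := fun x =>
    (((hWd x).add_const α).add ((hasDerivAt_id x).const_mul β)).congr_deriv (by ring)
  have hwdiff : Differentiable ℝ w := fun x => (hwd x).differentiableAt
  have hw' : deriv w = fun x => v x + β := funext fun x => (hwd x).deriv
  have hw'' : ∀ x, deriv (deriv w) x = deriv v x := fun x => by rw [hw', deriv_add_const]
  have hw'ac : ∀ a b, AbsolutelyContinuousOnInterval (deriv w) a b := by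
    intro a b
    rw [hw']
    exact (hvac a b).fun_add
      (contDiff_const (c := β)).contDiffOn.absolutelyContinuousOnInterval
  have hw'b : ∀ᵐ x, |deriv (deriv w) x| ≤ (2 + |μ|) * M * Real.exp |x| + |M * q x| := by
    filter_upwards [hv] with x hx
    rw [hw'', hx]; exact hbound x
  have hwb : ExpBounded w := expBounded_of_deriv_deriv hwdiff hw'ac (hq.const_mul M) hA hw'b
  have hzb : ExpBounded (fun x => u x - w x) := by
    have := hub.add (hwb.const_mul (-1))
    simpa [← sub_eq_add_neg] using this
  have hWb : ExpBounded (fun x => u x - W x) := by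
    have := hzb.add ((ExpBounded.of_abs_le (m := fun _ => α) (fun _ => le_rfl)).add
      (expBounded_id.const_mul β))
    convert this using 2 with x
    simp only [hw]; ring
  have hWc : Continuous W := continuous_iff_continuousAt.2 fun x => (hWd x).continuousAt
  have hzc : Continuous (fun x => u x - w x) := hu.sub hwdiff.continuous
  have iW : ∀ k, Integrable (fun x => (u x - W x) * hermiteFn k x) := fun k =>
    integrable_mul_of_rapid (hu.sub hWc).aestronglyMeasurable hWb (isRapid_hermiteFn k)
  have hcoeff : ∀ k, ∫ x, (u x - w x) * hermiteFn k x
      = (∫ x, (u x - W x) * hermiteFn k x) - α * (∫ x, hermiteFn k x)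
        - β * ∫ x, x * hermiteFn k x := by
    intro k
    have i0 := (isRapid_hermiteFn k).integrable
    have i1 := (isRapid_hermiteFn k).id_mul.integrable
    rw [← integral_const_mul, ← integral_const_mul, ← integral_sub (iW k) (i0.const_mul _),
      ← integral_sub ((iW k).sub' (i0.const_mul _)) (i1.const_mul _)]
    refine integral_congr_ae (Eventually.of_forall fun x => ?_)
    simp only [hw]; ring
  have hz : ∀ x, u x - w x = 0 := by
    refine eq_zero_of_integral_mul_potential hzc hzb (fun k => ?_) ?_ ?_
    · have hrap : IsRapid (fun x => (x ^ 2 - (2 * k + 1)) * hermiteFn k x) := by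
        convert ((isRapid_hermiteFn k).pow_mul 2).sub ((isRapid_hermiteFn k).const_mul (2 * k + 1))
          using 2 with x
        ring
      have e1 := integral_mul_deriv_deriv_hermiteFn hwdiff hw'ac (hq.const_mul M) hA hw'b k
      have e2 : (∫ x, deriv (deriv w) x * hermiteFn k x)
          = ∫ x, (x ^ 2 + q x - μ) * u x * hermiteFn k x := by
        refine integral_congr_ae ?_
        filter_upwards [hv] with x hx
        rw [hw'', hx]
      simp only [sub_mul (u _)]
      rw [integral_sub (integrable_mul_of_rapid hu.aestronglyMeasurable hub hrap)
        (integrable_mul_of_rapid hwdiff.continuous.aestronglyMeasurable hwb hrap), e1, e2, hweak,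
        sub_self]
    · have hodd : ∫ x, x * hermiteFn 0 x = 0 :=
        integral_eq_zero_of_odd fun x => by rw [hermiteFn_zero_neg]; ring
      rw [hcoeff, hodd, hα, div_mul_cancel₀ _ integral_hermiteFn_zero_pos.ne']
      ring
    · have hodd : ∫ x, hermiteFn 1 x = 0 := integral_eq_zero_of_odd hermiteFn_one_neg
      rw [hcoeff, hodd, hβ, div_mul_cancel₀ _ integral_mul_hermiteFn_one_pos.ne']
      ring
  have huw : u = w := funext fun x => by linarith [hz x]
  rw [← huw] at hwdiff hw'ac hw''
  refine ⟨hwdiff, hw'ac, ?_⟩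
  filter_upwards [hv] with x hx
  rw [hw'', hx]

theorem integral_sum_hermiteFn_sq (c : ℕ → ℝ) (N : ℕ) :
    Integrable (fun x => (∑ k ∈ Finset.range N, c k * hermiteFn k x) ^ 2) ∧
      ∫ x, (∑ k ∈ Finset.range N, c k * hermiteFn k x) ^ 2 = ∑ k ∈ Finset.range N, c k ^ 2 := by
  have hsq : ∀ x, (∑ k ∈ Finset.range N, c k * hermiteFn k x) ^ 2
      = ∑ j ∈ Finset.range N, ∑ k ∈ Finset.range N,
        c j * c k * (hermiteFn j x * hermiteFn k x) := by
    intro x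
    rw [sq, Finset.sum_mul_sum]
    exact Finset.sum_congr rfl fun j _ => Finset.sum_congr rfl fun k _ => by ring
  have hi : ∀ j k, Integrable (fun x => c j * c k * (hermiteFn j x * hermiteFn k x)) :=
    fun j k => (integrable_hermiteFn_mul j k).const_mul _
  simp only [hsq]
  refine ⟨integrable_finsetSum _ fun j _ => integrable_finsetSum _ fun k _ => hi j k, ?_⟩
  rw [integral_finsetSum _ fun j _ => integrable_finsetSum _ fun k _ => hi j k]
  refine Finset.sum_congr rfl fun j hj => ?_
  rw [integral_finsetSum _ fun k _ => hi j k]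
  simp only [integral_const_mul, integral_hermiteFn_mul, mul_ite, mul_one, mul_zero,
    Finset.sum_ite_eq, hj, if_true, sq]

theorem memLp_synth (b : SeqSpace) : MemLp (synth b) 2 volume := by
  rw [memLp_two_iff_integrable_sq (continuous_synth b).aestronglyMeasurable]
  have hint := integral_sum_hermiteFn_sq (fun k => b k * weight k)
  refine integrable_of_tendsto
    (G := fun N x => (∑ k ∈ Finset.range N, b k * weight k * hermiteFn k x) ^ 2)
    (Eventually.of_forall fun x => ((hasSum_synth b x).tendsto_sum_nat).pow 2)
    (fun N => (hint N).1.aestronglyMeasurable) ?_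
  refine ne_top_of_le_ne_top (ENNReal.ofReal_ne_top (r := ‖b‖ ^ 2)) ?_
  refine liminf_le_of_frequently_le' (Eventually.of_forall fun N => ?_).frequently
  rw [← ofReal_integral_norm_eq_lintegral_enorm (hint N).1]
  refine ENNReal.ofReal_le_ofReal ?_
  simp only [norm_pow, Real.norm_eq_abs, sq_abs]
  rw [(hint N).2]
  refine le_trans (Finset.sum_le_sum fun k _ => ?_) (b.sum_sq_le N)
  rw [mul_pow]
  exact mul_le_of_le_one_right (sq_nonneg _) (pow_le_one₀ (weight_pos k).le (weight_le_one k))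

theorem sum_sq_integral_mul_hermiteFn_le {u : ℝ → ℝ} (hu : MemLp u 2 volume) (n : ℕ)
    (hi : ∀ k, Integrable (fun x => u x * hermiteFn k x)) :
    ∑ k ∈ Finset.range n, (∫ x, u x * hermiteFn k x) ^ 2 ≤ ∫ x, u x ^ 2 := by
  set c : ℕ → ℝ := fun k => ∫ x, u x * hermiteFn k x with hc
  have h2 := integral_sum_hermiteFn_sq c n
  have h1 : Integrable (fun x => u x ^ 2) :=
    (memLp_two_iff_integrable_sq hu.1).1 hu
  have h3 : Integrable (fun x => ∑ k ∈ Finset.range n, c k * (u x * hermiteFn k x)) :=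
    integrable_finsetSum _ fun k _ => (hi k).const_mul _
  have h4 : ∫ x, ∑ k ∈ Finset.range n, c k * (u x * hermiteFn k x)
      = ∑ k ∈ Finset.range n, c k ^ 2 := by
    rw [integral_finsetSum _ fun k _ => (hi k).const_mul _]
    exact Finset.sum_congr rfl fun k _ => by rw [integral_const_mul, sq]
  have h5 : 0 ≤ ∫ x, (u x - ∑ k ∈ Finset.range n, c k * hermiteFn k x) ^ 2 :=
    integral_nonneg fun x => sq_nonneg _
  have h6 : ∫ x, (u x - ∑ k ∈ Finset.range n, c k * hermiteFn k x) ^ 2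
      = (∫ x, u x ^ 2) - 2 * (∫ x, ∑ k ∈ Finset.range n, c k * (u x * hermiteFn k x))
        + ∫ x, (∑ k ∈ Finset.range n, c k * hermiteFn k x) ^ 2 := by
    rw [← integral_const_mul, ← integral_sub h1 (h3.const_mul _),
      ← integral_add (h1.sub' (h3.const_mul _)) h2.1]
    refine integral_congr_ae (Eventually.of_forall fun x => ?_)
    simp only
    have : ∑ k ∈ Finset.range n, c k * (u x * hermiteFn k x)
        = u x * ∑ k ∈ Finset.range n, c k * hermiteFn k x := by
      rw [Finset.mul_sum]
      exact Finset.sum_congr rfl fun k _ => by ring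
    rw [this]; ring
  rw [h6, h4, h2.2] at h5
  linarith

theorem IsL2Solution.exists_synth_eq {q : ℝ → ℝ} (hq : Integrable q) (hq0 : ∀ᵐ x, 0 ≤ q x) {μ : ℝ}
    {u : ℝ → ℝ} (hu : IsL2Solution q μ u) :
    ∃ a : SeqSpace, a = μ • opS q hq a ∧ synth (μ • opR q hq (opD a)) = u := by
  obtain ⟨M, hM⟩ := hu.exists_bound hq0
  have hM0 : 0 ≤ M := (abs_nonneg _).trans (hM 0)
  have huc := hu.differentiable.continuous
  have hub := ExpBounded.of_abs_le hM
  have hi : ∀ k, Integrable (fun x => u x * hermiteFn k x) := fun k =>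
    integrable_mul_of_rapid huc.aestronglyMeasurable hub (isRapid_hermiteFn k)
  have hqu : Integrable (fun x => q x * u x) :=
    hq.mul_bdd (c := M) huc.aestronglyMeasurable (Eventually.of_forall hM)
  have heq : ∀ᵐ x, deriv (deriv u) x = (x ^ 2 + q x - μ) * u x := by
    filter_upwards [hu.equation] with x hx
    linarith
  have hweak : ∀ k : ℕ, (2 * k + 1) * (∫ x, u x * hermiteFn k x)
      + (∫ x, q x * u x * hermiteFn k x) = μ * ∫ x, u x * hermiteFn k x := by
    intro k
    rw [← weak_form_iff hq huc hM, integral_mul_deriv_deriv_hermiteFn hu.differentiable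
      hu.absolutelyContinuous_deriv (hq.const_mul M)
      (A := (2 + |μ|) * M) (by positivity) ?_ k]
    · refine integral_congr_ae ?_
      filter_upwards [heq] with x hx
      rw [hx]
    · filter_upwards [heq] with x hx
      rw [hx]; exact abs_potential_mul_le hM μ x
  let a : SeqSpace := ⟨fun k => ∫ x, u x * hermiteFn k x, memℓp_two_of_sum_sq_le fun n =>
    sum_sq_integral_mul_hermiteFn_le hu.memLp n hi⟩
  have ha : ∀ k, a k = ∫ x, u x * hermiteFn k x := fun k => rfl
  set b : SeqSpace := μ • opD a - coeffVec (fun x => q x * u x) with hb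
  have hbk : ∀ k : ℕ, b k = weight k * ((2 * k + 1) * a k) := by
    intro k
    rw [hb, lp.coeFn_sub, Pi.sub_apply, lp.coeFn_smul, Pi.smul_apply, opD_apply,
      coeffVec_apply hqu, ha, smul_eq_mul]
    linear_combination -weight k * hweak k
  have hwb : ∀ k : ℕ, weight k * b k = a k := by
    intro k
    rw [hbk, ← mul_assoc, ← sq, weight_sq]
    field_simp
  have hDb : opD b = a := by
    ext k
    rw [opD_apply, hwb]
  have hsb : synth b = u := by
    have h := eq_zero_of_integral_mul_hermiteFn (f := fun x => synth b x - u x)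
      ((continuous_synth b).sub huc)
      (ExpBounded.of_abs_le (M := 3 * ‖b‖ + M) fun x =>
        (abs_sub _ _).trans (add_le_add (abs_synth_le b x) (hM x))) (fun k => ?_)
    · exact funext fun x => sub_eq_zero.1 (h x)
    · simp only [sub_mul]
      rw [integral_sub (integrable_mul_of_rapid (continuous_synth b).aestronglyMeasurable
        (ExpBounded.of_abs_le (abs_synth_le b)) (isRapid_hermiteFn k)) (hi k),
        integral_synth_mul_hermiteFn, hwb, ha, sub_self]
  have hTb : opT q hq b = μ • opD a := by
    rw [opT_apply, hsb, hb, sub_add_cancel]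
  have hRb : b = μ • opR q hq (opD a) := by
    rw [← map_smul, ← hTb, opR_opT hq hq0]
  refine ⟨a, ?_, ?_⟩
  · rw [opS_apply, ← map_smul, ← hRb, hDb]
  · rw [← hRb, hsb]

theorem isL2Solution_synth {q : ℝ → ℝ} (hq : Integrable q) (hq0 : ∀ᵐ x, 0 ≤ q x) {μ : ℝ}
    {a : SeqSpace} (ha : a = μ • opS q hq a) :
    IsL2Solution q μ (synth (μ • opR q hq (opD a))) := by
  set b := μ • opR q hq (opD a) with hb
  have hDb : opD b = a := by rw [hb, map_smul, ← opS_apply, ← ha]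
  have hTb : opT q hq b = μ • opD a := by rw [hb, map_smul, opT_opR hq hq0]
  clear_value b
  have hcoeff : ∀ k, ∫ x, synth b x * hermiteFn k x = a k := by
    intro k
    rw [integral_synth_mul_hermiteFn, ← opD_apply, hDb]
  obtain ⟨h1, h2, h3⟩ := regularity_of_weak hq (continuous_synth b) (abs_synth_le b) μ
    (fun k => by
      rw [weak_form_iff hq (continuous_synth b) (abs_synth_le b), hcoeff]
      have hk : opT q hq b k = (μ • opD a) k := by rw [hTb]
      rw [opT_apply, lp.coeFn_add, Pi.add_apply, lp.coeFn_smul, Pi.smul_apply,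
        coeffVec_apply (integrable_mul_synth hq b), opD_apply, smul_eq_mul] at hk
      have hbk : a k = weight k * b k := by rw [← opD_apply, hDb]
      have hw := weight_sq k
      have hpos := weight_pos k
      have hw' : (2 * (k : ℝ) + 1) * weight k ^ 2 = 1 := by
        rw [hw]; field_simp
      refine mul_left_cancel₀ hpos.ne' ?_
      linear_combination hk + weight k * (2 * k + 1) * hbk + b k * hw')
  refine ⟨h1, h2, ?_, memLp_synth b⟩
  filter_upwards [h3] with x hx
  rw [hx]; ring

/-- Fixed vectors of `μ • opS` correspond to solutions. -/
def eigenspaceMap {q : ℝ → ℝ} (hq : Integrable q) (hq0 : ∀ᵐ x, 0 ≤ q x) (μ : ℝ) :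
    LinearMap.ker ((LinearMap.id : SeqSpace →ₗ[ℝ] SeqSpace)
      - μ • (opS q hq : SeqSpace →ₗ[ℝ] SeqSpace)) →ₗ[ℝ] eigenspace q μ where
  toFun a := ⟨synth (μ • opR q hq (opD a)), isL2Solution_synth hq hq0 (sub_eq_zero.1 a.2)⟩
  map_add' a b := by
    ext x
    show synth (μ • opR q hq (opD ((a : SeqSpace) + b))) x = synth _ x + synth _ x
    rw [map_add, map_add, smul_add, synth_add]
  map_smul' c a := by
    ext x
    show synth (μ • opR q hq (opD (c • (a : SeqSpace)))) x = c * synth _ x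
    rw [map_smul, map_smul, smul_comm, synth_smul]

theorem synth_eq_zero {b : SeqSpace} (h : ∀ x, synth b x = 0) : b = 0 := by
  ext k
  have := integral_synth_mul_hermiteFn b k
  simp only [h, zero_mul, integral_zero] at this
  exact (mul_eq_zero.1 this.symm).resolve_left (weight_pos k).ne'

theorem rank_eigenspace {q : ℝ → ℝ} (hq : Integrable q) (hq0 : ∀ᵐ x, 0 ≤ q x) (μ : ℝ) :
    Module.rank ℝ (eigenspace q μ) = Module.rank ℝ (LinearMap.ker
      ((LinearMap.id : SeqSpace →ₗ[ℝ] SeqSpace)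
        - μ • (opS q hq : SeqSpace →ₗ[ℝ] SeqSpace))) := by
  refine (LinearEquiv.rank_eq (LinearEquiv.ofBijective (eigenspaceMap hq hq0 μ) ⟨?_, ?_⟩)).symm
  · rw [← LinearMap.ker_eq_bot, LinearMap.ker_eq_bot']
    intro a ha
    have h : μ • opR q hq (opD (a : SeqSpace)) = 0 :=
      synth_eq_zero fun x => congrFun (congrArg Subtype.val ha) x
    have e : (a : SeqSpace) = μ • opS q hq a := sub_eq_zero.1 a.2
    refine Subtype.ext ?_
    rw [e, opS_apply, ← map_smul, h, map_zero]
    rfl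
  · intro u
    obtain ⟨a, ha, hu⟩ := IsL2Solution.exists_synth_eq hq hq0 u.2
    exact ⟨⟨a, sub_eq_zero.2 ha⟩, Subtype.ext hu⟩

theorem sum_integral_mul_hermiteFn_sq_le {q : ℝ → ℝ} (hq : Integrable q) (hq0 : ∀ᵐ x, 0 ≤ q x)
    (n : ℕ) : ∑ k ∈ Finset.range (n + 1), ∫ x, q x * hermiteFn k x ^ 2
      ≤ gammaTerm n / Real.pi * ∫ x, q x := by
  have hi : ∀ k, Integrable (fun x => q x * hermiteFn k x ^ 2) := by
    intro k
    obtain ⟨C, hC0, hC⟩ := (isRapid_hermiteFn k).exists_bound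
    refine hq.mul_bdd (c := C ^ 2) ((continuous_hermiteFn k).pow 2).aestronglyMeasurable
      (Eventually.of_forall fun x => ?_)
    rw [norm_pow, Real.norm_eq_abs]
    refine pow_le_pow_left₀ (abs_nonneg _) ((hC x).trans (mul_le_of_le_one_right hC0 ?_)) 2
    exact Real.exp_le_one_iff.2 (by nlinarith [sq_nonneg x])
  rw [← integral_finsetSum _ fun k _ => hi k, ← integral_const_mul]
  refine integral_mono_ae (integrable_finsetSum _ fun k _ => hi k) (hq.const_mul _) ?_
  filter_upwards [hq0] with x hx
  rw [← Finset.mul_sum, mul_comm]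
  exact mul_le_mul_of_nonneg_right (christoffel_le n x) hx

theorem sum_eigenvalue_shift_le {q : ℝ → ℝ} {lam : ℕ → ℝ} {n : ℕ}
    (h : ∑ j ∈ Finset.range (n + 1), lam j
      ≤ (∑ k ∈ Finset.range (n + 1), harmonicEigenvalue k) + gammaTerm n / Real.pi * ∫ x, q x) :
    ∑ k ∈ Finset.range (n + 1), (lam k - harmonicEigenvalue k
        - 1 / (Real.pi * √(harmonicEigenvalue k)) * ∫ x : ℝ, q x)
      ≤ chi n / Real.pi * ∫ x : ℝ, q x := by
  rw [Finset.sum_sub_distrib, Finset.sum_sub_distrib, ← Finset.sum_mul, chi_eq]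
  have e : ∑ k ∈ Finset.range (n + 1), 1 / (Real.pi * √(harmonicEigenvalue k))
      = (∑ k ∈ Finset.range (n + 1), 1 / √(harmonicEigenvalue k)) / Real.pi := by
    rw [Finset.sum_div]
    exact Finset.sum_congr rfl fun k _ => by rw [div_div, mul_comm]
  rw [e, sub_div, sub_mul]
  linarith

end PerturbedOscillator

end

theorem theorem3p1 :
    (∀ q : ℝ → ℝ, Integrable q volume → (∀ᵐ x : ℝ, 0 ≤ q x) →
      (∃ lam : ℕ → ℝ, PerturbedOscillator.IsEigenvalueSequence q lam) ∧
      ∀ lam : ℕ → ℝ, PerturbedOscillator.IsEigenvalueSequence q lam → ∀ n : ℕ,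
        ∑ k ∈ Finset.range (n + 1),
            (lam k - PerturbedOscillator.harmonicEigenvalue k
              - 1 / (Real.pi * √(PerturbedOscillator.harmonicEigenvalue k)) * ∫ x : ℝ, q x)
          ≤ PerturbedOscillator.chi n / Real.pi * ∫ x : ℝ, q x) ∧
    (fun n : ℕ => (PerturbedOscillator.chi n : ℂ) - -PerturbedOscillator.spectralZeta (1 / 2))
      =O[atTop] (fun n : ℕ => 1 / √(n : ℝ)) := by
  refine ⟨fun q hq hq0 => ?_, PerturbedOscillator.chi_asymptotics⟩
  obtain ⟨lam, hmono, hmult, hsum⟩ := PerturbedOscillator.exists_eigenvalues_opS hq hq0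
  have hlam : PerturbedOscillator.IsEigenvalueSequence q lam :=
    ⟨hmono, fun μ => (PerturbedOscillator.rank_eigenspace hq hq0 μ).trans (hmult μ)⟩
  refine ⟨⟨lam, hlam⟩, fun lam' hlam' n => ?_⟩
  have e : lam' = lam := PerturbedOscillator.eq_of_monotone_of_mk_fiber_eq hlam'.monotone hmono
    fun μ => (hlam'.multiplicity μ).symm.trans (hlam.multiplicity μ)
  rw [e]
  refine PerturbedOscillator.sum_eigenvalue_shift_le ((hsum n).trans ?_)
  rw [Finset.sum_add_distrib]
  exact add_le_add le_rfl (PerturbedOscillator.sum_integral_mul_hermiteFn_sq_le hq hq0 n)
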